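/- Let $Q_N=\{0,1\}^N$ be the hypercube graph, in which two binary strings are adjacent iff they differ in exactly one digit. For $0\le a\le 2^N$ let $I_a\subseteq Q_N$ be the initial segment of length $a$, i.e. the set of strings $x_0x_1\dots x_{N-1}$ which, read as binary representations of natural numbers, are $<a$. A pair $(a,b)$ of positive integers is called fit if for every $N$ with $a+b\le 2^N$ there are graph automorphisms $g_1,g_2\in\mathrm{Aut}(Q_N)$ such that $g_1(I_a)\cup g_2(I_b)=I_{a+b}$; otherwise it is called unfit. Let $t_n$ be the number of unfit pairs $(a,b)$ with $0<a\le 2^n$ and $0<b\le 2^n$. Then $t_4=24$, and for every $n\ge 5$ $$t_n = 2t_{n-1}+\sum_{j=4}^{n-2}2^{\,n-2-j}\,t_j+6\left(4^{n-2}-(n-1)2^{n-2}\right),$$ where the sum is empty (equal to $0$) for $n=5$. -/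

import Mathlib

/-- The hypercube graph `Q_n` on the binary strings of length `n`: two strings are adjacent
iff they differ in exactly one digit. -/
def hypercubeGraph (n : ℕ) : SimpleGraph (Fin n → Bool) where
  Adj x y := ∃! i, x i ≠ y i
  symm := ⟨fun _ _ ⟨i, hi, hu⟩ => ⟨i, hi.symm, fun j hj => hu j (Ne.symm hj)⟩⟩
  loopless := ⟨fun _ ⟨_, hi, _⟩ => hi rfl⟩

/-- The natural number with binary representation `x_0 x_1 … x_{n-1}` (`x_0` is the most
significant digit). -/
def binaryValue {n : ℕ} (x : Fin n → Bool) : ℕ :=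
  ∑ i : Fin n, (x i).toNat * 2 ^ (n - 1 - (i : ℕ))

/-- The initial segment `I_a ⊆ Q_n` of the binary order, meaningful for `a ≤ 2 ^ n`. -/
def initialSegment (n a : ℕ) : Set (Fin n → Bool) :=
  {x | binaryValue x < a}

/-- `(a, b)` is fit if, whenever `a + b ≤ 2 ^ n`, there are automorphisms `g₁, g₂` of `Q_n`
with `g₁(I_a) ∪ g₂(I_b) = I_{a+b}`. -/
def IsFit (a b : ℕ) : Prop :=
  ∀ n : ℕ, a + b ≤ 2 ^ n →
    ∃ g₁ g₂ : hypercubeGraph n ≃g hypercubeGraph n,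
      g₁ '' initialSegment n a ∪ g₂ '' initialSegment n b = initialSegment n (a + b)

/-- The set of unfit pairs `(a, b)` of positive integers with `a, b ≤ 2 ^ n`. -/
def unfitPairs (n : ℕ) : Set (ℕ × ℕ) :=
  {p | (0 < p.1 ∧ p.1 ≤ 2 ^ n) ∧ (0 < p.2 ∧ p.2 ≤ 2 ^ n) ∧ ¬ IsFit p.1 p.2}

/-- `t_n`, the number of unfit pairs `(a, b)` with `0 < a, b ≤ 2 ^ n`. -/
noncomputable def unfitCount (n : ℕ) : ℕ :=
  (unfitPairs n).ncard

/-! Nested sets are the images of initial segments under automorphisms, and they are closed under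
complement. So for any single `n` with a + b ≤ 2^n, the pair (a, b) is fit iff Q_n splits into three
nested classes of sizes a, b, c = 2^n - a - b (`isFit_iff_hasNestedColoring`). This condition is
symmetric in a, b, c.

Such splittings of Q_{n+1} are understood by class size. A class with at least 2^n points contains a
facet, and deleting that facet reduces to Q_n (`hasNestedColoring_succ_iff_update`). If every class
has at most 2^n points, each lies in a facet, and two of these facets are opposite, since otherwise
some point would avoid all three. The third class then fills what the other two leave in the
opposite halves. Its section sizes are two of the deficits u = 2^n - a, v = 2^n - b, w = 2^n - c,
and a nested set with given section sizes exists exactly when they form a dyadic pair. As u + v + w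
= 2^n, the new failures are the triples with this sum in which no two members form a dyadic pair.

Let U_n and W_n be the sizes of `uncolorablePairs n` and `nonDyadicPairs n`. Then t_n = U_n + W_n
and U_{n+1} = t_n + 2 U_n, and unrolling from U_4 = 0 turns U_{n-1} into the sum in the theorem. For
n ≥ 1 a triple counted by W_n is either all even, and can be halved, or has exactly one even member
in one of three positions, so W_n = W_{n-1} + 3 M_n. Two odd numbers form a dyadic pair only if
equal; an odd u and an even w do so iff w is the odd multiple nearest to u of the exact power of two
dividing w. For n ≥ 2 inclusion-exclusion gives M_n = 2 (4^{n-2} - (n-1) 2^{n-2}), and the recursion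
follows. -/

/-! ### Nested sets, facets and their sections -/

/-- Sets built from `∅` and the whole cube by repeatedly intersecting with, or adding, a facet
of the cube. These are exactly the images of initial segments under cube automorphisms. -/
inductive IsNested {n : ℕ} : Set (Fin n → Bool) → Prop
  | empty : IsNested ∅
  | univ : IsNested Set.univ
  | inter (i : Fin n) (b : Bool) {S : Set (Fin n → Bool)} :
      IsNested S → IsNested ({x | x i = b} ∩ S)
  | union (i : Fin n) (b : Bool) {S : Set (Fin n → Bool)} :
      IsNested S → IsNested ({x | x i = b} ∪ S)

theorem IsNested.facet {n : ℕ} (i : Fin n) (b : Bool) :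
    IsNested {x : Fin n → Bool | x i = b} := by
  simpa using IsNested.inter i b IsNested.univ

theorem setOf_ne_eq_facet {n : ℕ} (i : Fin n) (b : Bool) :
    {x : Fin n → Bool | x i = b}ᶜ = {x | x i = !b} := by
  ext x; cases b <;> simp

theorem IsNested.compl {n : ℕ} {S : Set (Fin n → Bool)} (h : IsNested S) : IsNested Sᶜ := by
  induction h with
  | empty => simpa using IsNested.univ
  | univ => simpa using IsNested.empty
  | inter i b _ ih => rw [Set.compl_inter, setOf_ne_eq_facet]; exact ih.union i _
  | union i b _ ih => rw [Set.compl_union, setOf_ne_eq_facet]; exact ih.inter i _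

/-- If every facet pulls back to everything, to nothing or to a facet, the construction of `S` can
be copied step by step. This covers sections, cylinders and automorphisms at once. -/
theorem IsNested.preimage {m n : ℕ} {φ : (Fin m → Bool) → (Fin n → Bool)}
    (hφ : ∀ j b, (∀ x, φ x j = b) ∨ (∀ x, φ x j ≠ b) ∨ ∃ i c, ∀ x, φ x j = b ↔ x i = c)
    {S : Set (Fin n → Bool)} (h : IsNested S) : IsNested (φ ⁻¹' S) := by
  induction h with
  | empty => exact IsNested.empty
  | univ => exact IsNested.univ
  | @inter j b S _ ih =>
    rw [Set.preimage_inter]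
    rcases hφ j b with h | h | ⟨i, c, h⟩
    · have : φ ⁻¹' {x | x j = b} = Set.univ := by ext x; simp [h x]
      rwa [this, Set.univ_inter]
    · have : φ ⁻¹' {x | x j = b} = ∅ := by ext x; simp [h x]
      rw [this, Set.empty_inter]; exact IsNested.empty
    · have : φ ⁻¹' {x | x j = b} = {x | x i = c} := by ext x; simp [h x]
      rw [this]; exact ih.inter i c
  | @union j b S _ ih =>
    rw [Set.preimage_union]
    rcases hφ j b with h | h | ⟨i, c, h⟩
    · have : φ ⁻¹' {x | x j = b} = Set.univ := by ext x; simp [h x]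
      rw [this, Set.univ_union]; exact IsNested.univ
    · have : φ ⁻¹' {x | x j = b} = ∅ := by ext x; simp [h x]
      rwa [this, Set.empty_union]
    · have : φ ⁻¹' {x | x j = b} = {x | x i = c} := by ext x; simp [h x]
      rw [this]; exact ih.union i c

/-- Insert the digit `b` at position `i`. -/
def insertBit {n : ℕ} (i : Fin (n + 1)) (b : Bool) (y : Fin n → Bool) : Fin (n + 1) → Bool :=
  i.insertNth (α := fun _ => Bool) b y

/-- Delete the digit at position `i`. -/
def dropBit {n : ℕ} (i : Fin (n + 1)) (x : Fin (n + 1) → Bool) : Fin n → Bool :=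
  fun k => x (i.succAbove k)

@[simp] theorem insertBit_same {n : ℕ} (i : Fin (n + 1)) (b : Bool) (y : Fin n → Bool) :
    insertBit i b y i = b := by simp [insertBit]

@[simp] theorem insertBit_succAbove {n : ℕ} (i : Fin (n + 1)) (b : Bool) (y : Fin n → Bool)
    (k : Fin n) : insertBit i b y (i.succAbove k) = y k := by simp [insertBit]

theorem insertBit_injective {n : ℕ} (i : Fin (n + 1)) (b : Bool) :
    Function.Injective (insertBit i b) := by
  intro y z h; funext k
  simpa using congrFun h (i.succAbove k)

theorem insertBit_dropBit {n : ℕ} (i : Fin (n + 1)) (x : Fin (n + 1) → Bool) :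
    insertBit i (x i) (dropBit i x) = x := by
  funext j
  rcases Fin.eq_self_or_eq_succAbove i j with rfl | ⟨k, rfl⟩ <;> simp [dropBit]

theorem dropBit_insertBit {n : ℕ} (i : Fin (n + 1)) (b : Bool) (y : Fin n → Bool) :
    dropBit i (insertBit i b y) = y := by
  funext k; simp [dropBit]

theorem IsNested.facetSection {n : ℕ} (i : Fin (n + 1)) (b : Bool) {S : Set (Fin (n + 1) → Bool)}
    (h : IsNested S) : IsNested (insertBit i b ⁻¹' S) := by
  refine h.preimage fun j c => ?_
  rcases Fin.eq_self_or_eq_succAbove i j with rfl | ⟨k, rfl⟩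
  · by_cases hb : b = c
    · left; simp [hb]
    · right; left; simp [hb]
  · right; right; exact ⟨k, c, by simp⟩

theorem IsNested.cylinder {n : ℕ} (i : Fin (n + 1)) {S : Set (Fin n → Bool)}
    (h : IsNested S) : IsNested {x : Fin (n + 1) → Bool | dropBit i x ∈ S} :=
  h.preimage (φ := fun x => dropBit i x) fun j c =>
    Or.inr (Or.inr ⟨i.succAbove j, c, fun x => by simp [dropBit]⟩)

theorem ncard_facet_inter {n : ℕ} (i : Fin (n + 1)) (b : Bool) (S : Set (Fin (n + 1) → Bool)) :
    ({x | x i = b} ∩ S).ncard = (insertBit i b ⁻¹' S).ncard := by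
  rw [← Set.ncard_image_of_injective _ (insertBit_injective i b)]
  congr 1
  ext x
  simp only [Set.mem_inter_iff, Set.mem_ofPred_eq, Set.mem_image, Set.mem_preimage]
  constructor
  · rintro ⟨rfl, h⟩
    exact ⟨dropBit i x, by rwa [insertBit_dropBit], insertBit_dropBit i x⟩
  · rintro ⟨y, h, rfl⟩
    exact ⟨by simp, h⟩

theorem ncard_facet_add {n : ℕ} (i : Fin n) (b : Bool) (S : Set (Fin n → Bool)) :
    ({x | x i = b} ∩ S).ncard + ({x | x i = !b} ∩ S).ncard = S.ncard := by
  rw [← setOf_ne_eq_facet, ← Set.ncard_inter_add_ncard_sdiff_eq_ncard S {x | x i = b},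
    Set.inter_comm, Set.sdiff_eq, Set.inter_comm S _ᶜ]

theorem ncard_insertBit_add {n : ℕ} (i : Fin (n + 1)) (b : Bool) (S : Set (Fin (n + 1) → Bool)) :
    (insertBit i b ⁻¹' S).ncard + (insertBit i (!b) ⁻¹' S).ncard = S.ncard := by
  rw [← ncard_facet_inter, ← ncard_facet_inter, ncard_facet_add]

theorem ncard_cube (n : ℕ) : (Set.univ : Set (Fin n → Bool)).ncard = 2 ^ n := by
  simp [Set.ncard_univ]

theorem ncard_add_ncard_compl_cube {n : ℕ} (S : Set (Fin n → Bool)) :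
    S.ncard + Sᶜ.ncard = 2 ^ n := by
  rw [Set.ncard_add_ncard_compl, ← Set.ncard_univ, ncard_cube]

theorem ncard_facet {n : ℕ} (i : Fin (n + 1)) (b : Bool) :
    {x : Fin (n + 1) → Bool | x i = b}.ncard = 2 ^ n := by
  have := ncard_facet_inter i b Set.univ
  simpa [ncard_cube] using this

/-- The last step of the construction decides. An intersection lies in its facet; a union contains a
facet, which already has 2^n points, so it equals that facet. -/
theorem IsNested.exists_subset_facet {n : ℕ} {S : Set (Fin (n + 1) → Bool)} (h : IsNested S)
    (hS : S.ncard ≤ 2 ^ n) : ∃ i b, S ⊆ {x | x i = b} := by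
  cases h with
  | empty => exact ⟨0, true, by simp⟩
  | univ =>
    rw [ncard_cube, pow_succ] at hS
    have := Nat.two_pow_pos n
    omega
  | inter i b _ => exact ⟨i, b, Set.inter_subset_left⟩
  | union i b _ =>
    refine ⟨i, b, (Set.eq_of_subset_of_ncard_le Set.subset_union_left ?_).symm.subset⟩
    rwa [ncard_facet]

theorem IsNested.exists_facet_subset {n : ℕ} {S : Set (Fin (n + 1) → Bool)} (h : IsNested S)
    (hS : 2 ^ n ≤ S.ncard) : ∃ i b, {x | x i = b} ⊆ S := by
  have h1 := ncard_add_ncard_compl_cube S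
  rw [pow_succ] at h1
  obtain ⟨i, b, hib⟩ := h.compl.exists_subset_facet (by omega)
  refine ⟨i, !b, ?_⟩
  rw [← setOf_ne_eq_facet, Set.compl_subset_comm]
  exact hib

/-! ### Automorphisms preserve nested sets -/

theorem hammingDist_of_adj {n : ℕ} {x y : Fin n → Bool} (h : (hypercubeGraph n).Adj x y) :
    hammingDist x y = 1 := by
  obtain ⟨i, hi, hu⟩ := h
  rw [hammingDist, Finset.card_eq_one]
  exact ⟨i, by ext j; simp only [Finset.mem_filter, Finset.mem_univ, true_and,
    Finset.mem_singleton]; exact ⟨hu j, fun h => h ▸ hi⟩⟩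

theorem hypercubeGraph_adj_update {n : ℕ} (x : Fin n → Bool) (i : Fin n) :
    (hypercubeGraph n).Adj x (Function.update x i (!x i)) := by
  refine ⟨i, by simp, fun j hj => ?_⟩
  by_contra hne
  simp [Function.update_of_ne hne] at hj

theorem hammingDist_eq_ite_add {n : ℕ} (x y : Fin n → Bool) (i : Fin n) :
    hammingDist x y =
      (if x i = y i then 0 else 1) + ∑ j ∈ Finset.univ.erase i, if x j = y j then 0 else 1 := by
  rw [Finset.add_sum_erase (s := Finset.univ) (f := fun j => if x j = y j then 0 else 1)
    (Finset.mem_univ i), hammingDist, Finset.card_filter]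
  exact Finset.sum_congr rfl fun j _ => by by_cases h : x j = y j <;> simp [h]

theorem hammingDist_update {n : ℕ} (x y : Fin n → Bool) (i : Fin n) (c : Bool) :
    hammingDist x (Function.update y i c) + (if x i = y i then 0 else 1) =
      hammingDist x y + (if x i = c then 0 else 1) := by
  rw [hammingDist_eq_ite_add x y i, hammingDist_eq_ite_add x _ i, Function.update_self]
  have : ∀ j ∈ Finset.univ.erase i, (if x j = Function.update y i c j then 0 else 1) =
      if x j = y j then 0 else 1 := by
    intro j hj
    rw [Function.update_of_ne (Finset.ne_of_mem_erase hj)]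
  rw [Finset.sum_congr rfl this]
  omega

/-- Flipping one differing digit of `y` moves it a step towards `x`, and a homomorphism sends that
edge to an edge. -/
theorem hammingDist_map_le {n : ℕ} (g : hypercubeGraph n →g hypercubeGraph n) (x y : Fin n → Bool) :
    hammingDist (g x) (g y) ≤ hammingDist x y := by
  induction h : hammingDist x y generalizing y with
  | zero => rw [hammingDist_eq_zero] at h; simp [h]
  | succ k ih =>
    have hne : x ≠ y := by rw [← hammingDist_ne_zero]; omega
    obtain ⟨i, hi⟩ := Function.ne_iff.mp hne
    have h1 := hammingDist_update x y i (!y i)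
    have h2 : x i = !y i := by revert hi; cases x i <;> cases y i <;> simp
    simp only [h2] at h1
    have h3 := ih (Function.update y i (!y i)) (by simp at h1; omega)
    have h4 := hammingDist_of_adj (g.map_adj (hypercubeGraph_adj_update y i))
    have h5 := hammingDist_triangle_right (g x) (g y) (g (Function.update y i (!y i)))
    omega

theorem hammingDist_iso {n : ℕ} (g : hypercubeGraph n ≃g hypercubeGraph n) (x y : Fin n → Bool) :
    hammingDist (g x) (g y) = hammingDist x y := by
  refine le_antisymm (hammingDist_map_le g.toHom x y) ?_
  simpa using hammingDist_map_le g.symm.toHom (g x) (g y)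

theorem hammingDist_lt_iff_of_adj {n : ℕ} {y z : Fin n → Bool} {i : Fin n} (hi : y i ≠ z i)
    (hu : ∀ j, y j ≠ z j → j = i) (x : Fin n → Bool) :
    hammingDist x y < hammingDist x z ↔ x i = y i := by
  have hz : z = Function.update y i (z i) := by
    funext j
    by_cases hj : j = i
    · subst hj; simp
    · rw [Function.update_of_ne hj]
      by_contra h
      exact hj (hu j (Ne.symm h))
  have h := hammingDist_update x y i (z i)
  rw [← hz] at h
  by_cases h1 : x i = y i
  · have h2 : x i ≠ z i := h1 ▸ hi
    simp only [h1, if_true, hi, if_false] at h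
    simp only [h1, iff_true]; omega
  · simp only [h1, if_false] at h
    simp only [h1, iff_false]
    split_ifs at h <;> omega

/-- A facet consists of the points nearer to one end of an edge than to the other. Automorphisms are
isometries, so they carry facets to facets. -/
theorem IsNested.preimage_iso {n : ℕ} (g : hypercubeGraph n ≃g hypercubeGraph n)
    {S : Set (Fin n → Bool)} (h : IsNested S) : IsNested (g ⁻¹' S) := by
  refine h.preimage fun j b => Or.inr (Or.inr ?_)
  -- Any edge in direction `j` whose end `y` has digit `b` there would serve.
  set y : Fin n → Bool := fun _ => b
  set z : Fin n → Bool := Function.update y j (!b)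
  have hyz : (hypercubeGraph n).Adj y z := hypercubeGraph_adj_update y j
  obtain ⟨i, hi, hu⟩ := g.symm.map_adj_iff.mpr hyz
  refine ⟨i, g.symm y i, fun x => ?_⟩
  rw [← hammingDist_lt_iff_of_adj hi hu x]
  have h1 : ∀ j', y j' ≠ z j' → j' = j := by
    intro j' hj'
    by_contra hne
    simp [z, Function.update_of_ne hne] at hj'
  have h2 := hammingDist_lt_iff_of_adj (y := y) (z := z) (i := j) (by simp [y, z]) h1 (g x)
  rw [← h2, ← hammingDist_iso g.symm, ← hammingDist_iso g.symm (g x) z]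
  simp

theorem IsNested.image_iso {n : ℕ} (g : hypercubeGraph n ≃g hypercubeGraph n)
    {S : Set (Fin n → Bool)} (h : IsNested S) : IsNested (g '' S) := by
  have := h.preimage_iso g.symm
  have h2 : g '' S = g.symm ⁻¹' S := g.toEquiv.image_eq_preimage_symm S
  rwa [h2]

/-! ### Nested sets are the images of initial segments -/

theorem binaryValue_succ {n : ℕ} (x : Fin (n + 1) → Bool) :
    binaryValue x = (x 0).toNat * 2 ^ n + binaryValue (dropBit 0 x) := by
  simp only [binaryValue, Fin.sum_univ_succ, dropBit, Fin.zero_succAbove]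
  congr 1
  refine Finset.sum_congr rfl fun i _ => ?_
  congr 2
  simp; omega

theorem binaryValue_lt {n : ℕ} (x : Fin n → Bool) : binaryValue x < 2 ^ n := by
  induction n with
  | zero => simp [binaryValue]
  | succ n ih =>
    rw [binaryValue_succ, pow_succ]
    have := ih (dropBit 0 x)
    cases x 0 <;> simp <;> omega

theorem mem_initialSegment_succ {n a : ℕ} (x : Fin (n + 1) → Bool) :
    x ∈ initialSegment (n + 1) a ↔
      dropBit 0 x ∈ initialSegment n (bif x 0 then a - 2 ^ n else a) := by
  simp only [initialSegment, Set.mem_ofPred_eq, binaryValue_succ]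
  cases x 0 <;> simp; omega

theorem initialSegment_zero (n : ℕ) : initialSegment n 0 = ∅ := by
  ext; simp [initialSegment]

theorem initialSegment_of_le {n a : ℕ} (h : 2 ^ n ≤ a) : initialSegment n a = Set.univ := by
  ext x; simpa [initialSegment] using (binaryValue_lt x).trans_le h

theorem isNested_initialSegment (n a : ℕ) : IsNested (initialSegment n a) := by
  induction n generalizing a with
  | zero =>
    rcases Nat.eq_zero_or_pos a with rfl | h
    · rw [initialSegment_zero]; exact IsNested.empty
    · rw [initialSegment_of_le (by simpa using Nat.succ_le_of_lt h)]; exact IsNested.univ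
  | succ n ih =>
    rcases le_total a (2 ^ n) with h | h
    · have : initialSegment (n + 1) a =
          {x | x 0 = false} ∩ {x | dropBit 0 x ∈ initialSegment n a} := by
        ext x
        rw [mem_initialSegment_succ]
        cases hx : x 0 <;> simp [hx, Nat.sub_eq_zero_of_le h, initialSegment_zero]
      rw [this]
      exact ((ih a).cylinder 0).inter 0 false
    · have : initialSegment (n + 1) a =
          {x | x 0 = false} ∪ {x | dropBit 0 x ∈ initialSegment n (a - 2 ^ n)} := by
        ext x
        rw [mem_initialSegment_succ]
        cases hx : x 0 <;> simp [hx, initialSegment_of_le h]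
      rw [this]
      exact ((ih _).cylinder 0).union 0 false

theorem preimage_insertBit_zero_initialSegment (n a : ℕ) (b : Bool) :
    insertBit 0 b ⁻¹' initialSegment (n + 1) a =
      initialSegment n (bif b then a - 2 ^ n else a) := by
  ext y
  rw [Set.mem_preimage, mem_initialSegment_succ, insertBit_same, dropBit_insertBit]

theorem ncard_initialSegment {n a : ℕ} (h : a ≤ 2 ^ n) : (initialSegment n a).ncard = a := by
  induction n generalizing a with
  | zero =>
    obtain rfl | rfl : a = 0 ∨ a = 1 := by simp at h; omega
    · simp [initialSegment_zero]
    · rw [initialSegment_of_le (by simp), ncard_cube]; simp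
  | succ n ih =>
    rw [pow_succ] at h
    rw [← ncard_insertBit_add 0 true, preimage_insertBit_zero_initialSegment,
      preimage_insertBit_zero_initialSegment]
    simp only [cond_true, Bool.not_true, cond_false]
    rcases le_total a (2 ^ n) with h1 | h1
    · rw [Nat.sub_eq_zero_of_le h1, initialSegment_zero, ih h1]; simp
    · rw [initialSegment_of_le h1, ncard_cube, ih (by omega)]; omega

/-- The automorphism of the cube moving the first digit to position `j`, flipping it if `b`, and
acting by `h` on the other digits. -/
def extendIso {n : ℕ} (j : Fin (n + 1)) (b : Bool) (h : hypercubeGraph n ≃g hypercubeGraph n) :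
    hypercubeGraph (n + 1) ≃g hypercubeGraph (n + 1) where
  toFun x := insertBit j (x 0 ^^ b) (h (dropBit 0 x))
  invFun x := insertBit 0 (x j ^^ b) (h.symm (dropBit j x))
  left_inv x := by simp [dropBit_insertBit, insertBit_dropBit]
  right_inv x := by simp [dropBit_insertBit, insertBit_dropBit]
  map_rel_iff' {x y} := by
    have key : ∀ (j : Fin (n + 1)) (u v : Fin (n + 1) → Bool), (hypercubeGraph (n + 1)).Adj u v ↔
        (u j = v j ∧ (hypercubeGraph n).Adj (dropBit j u) (dropBit j v)) ∨
        (u j ≠ v j ∧ dropBit j u = dropBit j v) := by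
      intro j u v
      simp only [hypercubeGraph]
      constructor
      · rintro ⟨i, hi, hu⟩
        by_cases hj : u j = v j
        · left
          rcases Fin.eq_self_or_eq_succAbove j i with rfl | ⟨k, rfl⟩
          · exact absurd hj hi
          · refine ⟨hj, k, hi, fun l hl => ?_⟩
            exact Fin.succAbove_right_injective (hu _ hl)
        · right
          refine ⟨hj, ?_⟩
          funext l
          by_contra hl
          exact Fin.succAbove_ne j l ((hu _ hl).trans (hu j hj).symm)
      · rintro (⟨hj, k, hk, hu⟩ | ⟨hj, he⟩)
        · refine ⟨j.succAbove k, hk, fun i hi => ?_⟩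
          rcases Fin.eq_self_or_eq_succAbove j i with rfl | ⟨l, rfl⟩
          · exact absurd hj hi
          · rw [hu l hi]
        · refine ⟨j, hj, fun i hi => ?_⟩
          rcases Fin.eq_self_or_eq_succAbove j i with rfl | ⟨l, rfl⟩
          · rfl
          · exact absurd (congrFun he l) hi
    rw [key j, key 0 x y]
    simp [dropBit_insertBit, h.map_adj_iff]

/-- According to its size, `S` lies in a facet or contains one. Matching that facet with the half of
leading digit 0 leaves one undetermined section, which the induction handles. -/
theorem IsNested.exists_iso {n : ℕ} {S : Set (Fin n → Bool)} (hS : IsNested S) :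
    ∃ g : hypercubeGraph n ≃g hypercubeGraph n, S = g '' initialSegment n S.ncard := by
  induction n with
  | zero =>
    refine ⟨SimpleGraph.Iso.refl, ?_⟩
    rcases Set.eq_empty_or_nonempty S with rfl | ⟨x, hx⟩
    · simp [initialSegment_zero]
    · have : S = Set.univ := Set.eq_univ_of_forall fun y => Subsingleton.elim x y ▸ hx
      rw [this, ncard_cube, initialSegment_of_le le_rfl]; ext; simp
  | succ n ih =>
    suffices H : ∃ j b, ∃ h : hypercubeGraph n ≃g hypercubeGraph n, ∀ c,
        insertBit j (c ^^ b) ⁻¹' S = h '' initialSegment n (bif c then S.ncard - 2 ^ n else S.ncard)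
        by
      obtain ⟨j, b, h, hh⟩ := H
      refine ⟨extendIso j b h, ?_⟩
      have h1 : ∀ x, x ∈ initialSegment (n + 1) S.ncard ↔ extendIso j b h x ∈ S := by
        intro x
        have h2 : extendIso j b h x ∈ S ↔
            h (dropBit 0 x) ∈ insertBit j (x 0 ^^ b) ⁻¹' S := Iff.rfl
        rw [mem_initialSegment_succ, h2, hh, h.injective.mem_set_image]
      ext y
      constructor
      · intro hy
        refine ⟨(extendIso j b h).symm y, ?_, by simp⟩
        rw [h1]; simpa using hy
      · rintro ⟨x, hx, rfl⟩
        exact (h1 x).1 hx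
    rcases le_total S.ncard (2 ^ n) with h | h
    · obtain ⟨j, b, hj⟩ := hS.exists_subset_facet h
      have he : insertBit j (!b) ⁻¹' S = ∅ := by
        ext y
        simp only [Set.mem_preimage, Set.mem_empty_iff_false, iff_false]
        intro hy
        have := hj hy
        simp at this
      have hc := ncard_insertBit_add j b S
      rw [he, Set.ncard_empty, add_zero] at hc
      obtain ⟨g, hg⟩ := ih (hS.facetSection j b)
      refine ⟨j, b, g, fun c => ?_⟩
      cases c
      · simp only [Bool.false_xor, cond_false]; rw [← hc]; exact hg
      · simp only [Bool.true_xor, cond_true]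
        rw [he, Nat.sub_eq_zero_of_le h, initialSegment_zero, Set.image_empty]
    · obtain ⟨j, b, hj⟩ := hS.exists_facet_subset h
      have he : insertBit j b ⁻¹' S = Set.univ := by
        ext y
        simp only [Set.mem_preimage, Set.mem_univ, iff_true]
        exact hj (by simp)
      have hc := ncard_insertBit_add j b S
      rw [he, ncard_cube] at hc
      obtain ⟨g, hg⟩ := ih (hS.facetSection j (!b))
      refine ⟨j, b, g, fun c => ?_⟩
      cases c
      · simp only [Bool.false_xor, cond_false]
        rw [he, initialSegment_of_le h, Set.image_univ, g.surjective.range_eq]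
      · simp only [Bool.true_xor, cond_true]
        rw [show S.ncard - 2 ^ n = (insertBit j (!b) ⁻¹' S).ncard by omega]
        exact hg

/-! ### Dyadic pairs as section sizes of nested sets -/

/-- `u` and `v` lie in a common dyadic interval `[q 2 ^ k, (q + 1) 2 ^ k]`, and one of them is an
endpoint of it. -/
def IsDyadicPair (u v : ℕ) : Prop :=
  ∃ k : ℕ, (2 ^ k ∣ u ∨ 2 ^ k ∣ v) ∧ u ≤ v + 2 ^ k ∧ v ≤ u + 2 ^ k

theorem IsDyadicPair.symm {u v : ℕ} (h : IsDyadicPair u v) : IsDyadicPair v u := by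
  obtain ⟨k, h1, h2, h3⟩ := h
  exact ⟨k, h1.symm, h3, h2⟩

theorem isDyadicPair_comm {u v : ℕ} : IsDyadicPair u v ↔ IsDyadicPair v u :=
  ⟨IsDyadicPair.symm, IsDyadicPair.symm⟩

theorem isDyadicPair_zero_left (v : ℕ) : IsDyadicPair 0 v :=
  ⟨v, by simp, by simp, by simpa using Nat.lt_two_pow_self.le⟩

theorem IsDyadicPair.exists_le {n u v : ℕ} (h : IsDyadicPair u v) (hu : u ≤ 2 ^ n)
    (hv : v ≤ 2 ^ n) : ∃ k ≤ n, (2 ^ k ∣ u ∨ 2 ^ k ∣ v) ∧ u ≤ v + 2 ^ k ∧ v ≤ u + 2 ^ k := by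
  obtain ⟨k, h1, h2, h3⟩ := h
  rcases le_total k n with hk | hk
  · exact ⟨k, hk, h1, h2, h3⟩
  · exact ⟨n, le_rfl, h1.imp (pow_dvd_pow 2 hk).trans (pow_dvd_pow 2 hk).trans, by omega, by omega⟩

theorem IsDyadicPair.of_add_eq_two_pow {n u v u' v' : ℕ} (h : IsDyadicPair u v)
    (hu : u + u' = 2 ^ n) (hv : v + v' = 2 ^ n) : IsDyadicPair u' v' := by
  obtain ⟨k, hk, h1, h2, h3⟩ := h.exists_le (n := n) (by omega) (by omega)
  have hd : 2 ^ k ∣ 2 ^ n := pow_dvd_pow 2 hk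
  refine ⟨k, h1.imp (fun h => ?_) (fun h => ?_), by omega, by omega⟩
  · rwa [← Nat.dvd_add_right h, hu]
  · rwa [← Nat.dvd_add_right h, hv]

/-- Complementing reflects both sizes in 2^n and keeps the pair dyadic, so `S` may be assumed to lie
in a facet. If that facet has direction `i`, one section is empty; otherwise restricting to it
changes no size and induction applies. -/
theorem IsNested.isDyadicPair {n : ℕ} {S : Set (Fin n → Bool)} (hS : IsNested S) (i : Fin n) :
    IsDyadicPair ({x | x i = false} ∩ S).ncard ({x | x i = true} ∩ S).ncard := by
  induction n with
  | zero => exact i.elim0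
  | succ n ih =>
    have H : ∀ {T : Set (Fin (n + 1) → Bool)}, IsNested T → T.ncard ≤ 2 ^ n →
        IsDyadicPair ({x | x i = false} ∩ T).ncard ({x | x i = true} ∩ T).ncard := by
      intro T hT hc
      obtain ⟨j, b, hj⟩ := hT.exists_subset_facet hc
      rcases Fin.eq_self_or_eq_succAbove j i with rfl | ⟨k, rfl⟩
      · have he : ∀ c, c ≠ b → {x : Fin (n + 1) → Bool | x i = c} ∩ T = ∅ := by
          intro c hcb
          ext x
          simp only [Set.mem_inter_iff, Set.mem_ofPred_eq, Set.mem_empty_iff_false, iff_false]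
          rintro ⟨rfl, hx⟩
          exact hcb (hj hx)
        cases b
        · rw [he true (by simp), Set.ncard_empty]; exact (isDyadicPair_zero_left _).symm
        · rw [he false (by simp), Set.ncard_empty]; exact isDyadicPair_zero_left _
      · have hs : ∀ c, ({x : Fin (n + 1) → Bool | x (j.succAbove k) = c} ∩ T).ncard =
            ({y | y k = c} ∩ insertBit j b ⁻¹' T).ncard := by
          intro c
          have h1 : {x : Fin (n + 1) → Bool | x (j.succAbove k) = c} ∩ T =
              {x | x j = b} ∩ ({x | x (j.succAbove k) = c} ∩ T) :=
            (Set.inter_eq_right.2 (Set.inter_subset_right.trans hj)).symm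
          rw [h1, ncard_facet_inter]
          congr 1
          ext y
          simp
        rw [hs, hs]
        exact ih (hT.facetSection j b) k
    rcases le_total S.ncard (2 ^ n) with h | h
    · exact H hS h
    · have h1 := ncard_add_ncard_compl_cube S
      rw [pow_succ] at h1
      have h2 : ∀ c, ({x | x i = c} ∩ Sᶜ).ncard + ({x | x i = c} ∩ S).ncard = 2 ^ n := by
        intro c
        rw [ncard_facet_inter, ncard_facet_inter, add_comm, Set.preimage_compl,
          ncard_add_ncard_compl_cube]
      exact (H hS.compl (by omega)).of_add_eq_two_pow (h2 false) (h2 true)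

/-- An empty or full half is a single facet operation. Otherwise `u` and `v` lie on the same side of
the midpoint, so a facet in the second digit is avoided or filled by both halves and can be stripped
off. -/
theorem isNested_of_isDyadicPair {n u v : ℕ} (hu : u ≤ 2 ^ n) (hv : v ≤ 2 ^ n)
    (h : IsDyadicPair u v) :
    IsNested {x : Fin (n + 1) → Bool | dropBit 0 x ∈ initialSegment n (bif x 0 then v else u)} := by
  have base : ∀ {n u v : ℕ}, (u = 0 ∨ u = 2 ^ n) ∨ (v = 0 ∨ v = 2 ^ n) →
      IsNested {x : Fin (n + 1) → Bool |
        dropBit 0 x ∈ initialSegment n (bif x 0 then v else u)} := by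
    intro n u v h
    rcases h with (rfl | rfl) | (rfl | rfl)
    · convert ((isNested_initialSegment n v).cylinder 0).inter 0 true using 1
      ext x
      cases hx : x 0 <;> simp [hx, initialSegment_zero]
    · convert ((isNested_initialSegment n v).cylinder 0).union 0 false using 1
      ext x
      cases hx : x 0 <;> simp [hx, initialSegment_of_le]
    · convert ((isNested_initialSegment n u).cylinder 0).inter 0 false using 1
      ext x
      cases hx : x 0 <;> simp [hx, initialSegment_zero]
    · convert ((isNested_initialSegment n u).cylinder 0).union 0 true using 1
      ext x
      cases hx : x 0 <;> simp [hx, initialSegment_of_le]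
  induction n generalizing u v with
  | zero => exact base (by simp at hu hv ⊢; omega)
  | succ n ih =>
    by_cases hb : (u = 0 ∨ u = 2 ^ (n + 1)) ∨ (v = 0 ∨ v = 2 ^ (n + 1))
    · exact base hb
    have hdrop : ∀ x : Fin (n + 2) → Bool, dropBit 0 (dropBit 0 x) = dropBit 0 (dropBit 1 x) := by
      intro x; funext k; simp [dropBit]
    have h0 : ∀ x : Fin (n + 2) → Bool, dropBit 0 x 0 = x 1 := fun x => by simp [dropBit]
    have h1 : ∀ x : Fin (n + 2) → Bool, dropBit 1 x 0 = x 0 := fun x => by simp [dropBit]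
    by_cases hle : u ≤ 2 ^ n ∧ v ≤ 2 ^ n
    · convert ((ih hle.1 hle.2 h).cylinder 1).inter 1 false using 1
      ext x
      simp only [Set.mem_ofPred_eq, Set.mem_inter_iff, mem_initialSegment_succ, hdrop, h0, h1]
      cases hx : x 1 <;> cases x 0 <;>
        simp [Nat.sub_eq_zero_of_le hle.1, Nat.sub_eq_zero_of_le hle.2, initialSegment_zero]
    by_cases hge : 2 ^ n ≤ u ∧ 2 ^ n ≤ v
    · rw [pow_succ] at hu hv
      have hs : IsDyadicPair (u - 2 ^ n) (v - 2 ^ n) := by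
        refine IsDyadicPair.of_add_eq_two_pow (n := n) (u := 2 ^ (n + 1) - u)
          (v := 2 ^ (n + 1) - v) ?_ (by rw [pow_succ]; omega) (by rw [pow_succ]; omega)
        exact h.of_add_eq_two_pow (n := n + 1) (by rw [pow_succ]; omega) (by rw [pow_succ]; omega)
      convert ((ih (u := u - 2 ^ n) (v := v - 2 ^ n) (by omega) (by omega) hs).cylinder 1).union
        1 false using 1
      ext x
      simp only [Set.mem_ofPred_eq, Set.mem_union, mem_initialSegment_succ, hdrop, h0, h1]
      cases hx : x 1 <;> cases x 0 <;>
        simp [initialSegment_of_le hge.1, initialSegment_of_le hge.2]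
    -- A dyadic interval of length at most half the range cannot straddle the midpoint. The full
    -- length would make `u` or `v` extreme, which `hb` excludes.
    exfalso
    obtain ⟨k, hk, hd, h2, h3⟩ := h.exists_le hu hv
    rcases Nat.lt_or_ge n k with hnk | hnk
    · obtain rfl : k = n + 1 := by omega
      apply hb
      refine hd.imp (fun hd => ?_) (fun hd => ?_)
      · rcases Nat.eq_zero_or_pos u with h | h
        · exact Or.inl h
        · exact Or.inr (le_antisymm hu (Nat.le_of_dvd h hd))
      · rcases Nat.eq_zero_or_pos v with h | h
        · exact Or.inl h
        · exact Or.inr (le_antisymm hv (Nat.le_of_dvd h hd))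
    · have key : ∀ a b : ℕ, 2 ^ k ∣ a → (a < 2 ^ n → b ≤ a + 2 ^ k → b ≤ 2 ^ n) ∧
          (2 ^ n < a → a ≤ b + 2 ^ k → 2 ^ n ≤ b) := by
        intro a b ⟨c, hc⟩
        obtain ⟨d, hd⟩ : 2 ^ k ∣ 2 ^ n := pow_dvd_pow 2 hnk
        have hp := Nat.two_pow_pos k
        rw [hc, hd]
        constructor
        · intro h1 h2
          have h3 : c + 1 ≤ d := Nat.lt_of_mul_lt_mul_left h1
          have := Nat.mul_le_mul_left (2 ^ k) h3
          rw [mul_add] at this; omega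
        · intro h1 h2
          have h3 : d + 1 ≤ c := Nat.lt_of_mul_lt_mul_left h1
          have := Nat.mul_le_mul_left (2 ^ k) h3
          rw [mul_add] at this; omega
      rcases hd with hd | hd
      · have := key u v hd; omega
      · have := key v u hd; omega

/-! ### Nested three-colourings of the cube -/

/-- The cube `Q_n` can be coloured with three colours such that each colour class is nested, the
class of colour `t` having `a t` elements. -/
def HasNestedColoring (n : ℕ) (a : Fin 3 → ℕ) : Prop :=
  ∃ f : (Fin n → Bool) → Fin 3, ∀ t, IsNested (f ⁻¹' {t}) ∧ (f ⁻¹' {t}).ncard = a t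

theorem hasNestedColoring_succ_iff_update {n : ℕ} {a : Fin 3 → ℕ} {t : Fin 3} (ht : 2 ^ n ≤ a t) :
    HasNestedColoring (n + 1) a ↔
      HasNestedColoring n (Function.update a t (a t - 2 ^ n)) := by
  constructor
  · rintro ⟨f, hf⟩
    obtain ⟨i, b, hib⟩ := (hf t).1.exists_facet_subset (by rw [(hf t).2]; exact ht)
    refine ⟨f ∘ insertBit i (!b), fun s => ⟨(hf s).1.facetSection i (!b), ?_⟩⟩
    have h := ncard_insertBit_add i b (f ⁻¹' {s})
    rw [(hf s).2] at h
    have h1 : ∀ y, f (insertBit i b y) = t := fun y => hib (by simp)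
    rw [Set.preimage_comp]
    by_cases hs : s = t
    · subst hs
      have h2 : insertBit i b ⁻¹' (f ⁻¹' {s}) = Set.univ := by ext y; simp [h1]
      rw [h2, ncard_cube] at h
      simp only [Function.update_self]; omega
    · have h2 : insertBit i b ⁻¹' (f ⁻¹' {s}) = ∅ := by ext y; simp [h1, Ne.symm hs]
      rw [h2, Set.ncard_empty] at h
      simp only [Function.update_of_ne hs]; omega
  · rintro ⟨f, hf⟩
    set F : (Fin (n + 1) → Bool) → Fin 3 := fun x => if x 0 = false then t else f (dropBit 0 x)
      with hF
    have hF1 : ∀ y, F (insertBit 0 true y) = f y := fun y => by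
      simp [hF, dropBit_insertBit]
    have hF0 : ∀ y, F (insertBit 0 false y) = t := fun y => by simp [hF]
    refine ⟨F, fun s => ?_⟩
    have h := ncard_insertBit_add 0 true (F ⁻¹' {s})
    have h1 : insertBit 0 true ⁻¹' (F ⁻¹' {s}) = f ⁻¹' {s} := by ext y; simp [hF1]
    rw [h1, (hf s).2] at h
    by_cases hs : s = t
    · subst hs
      have h2 : insertBit 0 (!true) ⁻¹' (F ⁻¹' {s}) = Set.univ := by ext y; simp [hF0]
      rw [h2, ncard_cube, Function.update_self] at h
      refine ⟨?_, by omega⟩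
      convert ((hf s).1.cylinder 0).union 0 false using 1
      ext x
      cases hx : x 0 <;> simp [hF, hx]
    · have h2 : insertBit 0 (!true) ⁻¹' (F ⁻¹' {s}) = ∅ := by ext y; simp [hF0, Ne.symm hs]
      rw [h2, Set.ncard_empty, Function.update_of_ne hs] at h
      refine ⟨?_, by omega⟩
      convert ((hf s).1.cylinder 0).inter 0 true using 1
      ext x
      cases hx : x 0 <;> simp [hF, hx, Ne.symm hs]

theorem exists_third_color {s t : Fin 3} (hst : s ≠ t) :
    ∃ r : Fin 3, r ≠ s ∧ r ≠ t ∧ ∀ q, q = r ∨ q = s ∨ q = t := by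
  revert s t; decide

theorem HasNestedColoring.exists_isDyadicPair {n : ℕ} {a : Fin 3 → ℕ}
    (h : HasNestedColoring (n + 1) a) (ha : ∀ t, a t ≤ 2 ^ n) :
    ∃ s t, s ≠ t ∧ IsDyadicPair (2 ^ n - a s) (2 ^ n - a t) := by
  obtain ⟨f, hf⟩ := h
  have h1 : ∀ t, ∃ i b, f ⁻¹' {t} ⊆ {x | x i = b} := fun t =>
    (hf t).1.exists_subset_facet (by rw [(hf t).2]; exact ha t)
  choose j b hjb using h1
  -- If no two of the chosen facets were opposite, a point could disagree with each facet in its own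
  -- direction; but it must lie in the facet of its own colour.
  obtain ⟨s, t, hj, hs, ht⟩ : ∃ s t, j s = j t ∧ b s = false ∧ b t = true := by
    by_contra! hne
    let x : Fin (n + 1) → Bool := fun i => decide (¬ ∃ t, j t = i ∧ b t = true)
    have hx : x (j (f x)) = b (f x) := hjb (f x) rfl
    cases hb : b (f x) with
    | false =>
      rw [hb] at hx
      simp only [x, decide_eq_false_iff_not, not_not] at hx
      obtain ⟨t, h1, h2⟩ := hx
      exact hne _ t h1.symm hb h2
    | true =>
      rw [hb] at hx
      simp only [x, decide_eq_true_eq] at hx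
      exact hx ⟨_, rfl, hb⟩
  have hst : s ≠ t := by rintro rfl; simp [hs] at ht
  refine ⟨s, t, hst, ?_⟩
  obtain ⟨r, hrs, hrt, hall⟩ := exists_third_color hst
  -- In the half containing class `p` the class `q` is absent, so `r` fills everything that `p`
  -- leaves.
  have key : ∀ p q c, p ≠ q → (∀ o, o = r ∨ o = p ∨ o = q) → r ≠ p → j p = j s → b p = c →
      j q = j s → b q = !c → ({x | x (j s) = c} ∩ f ⁻¹' {r}).ncard = 2 ^ n - a p := by
    intro p q c hpq hall hrp hp hbp hq hbq
    have h2 : {x | x (j s) = c} ∩ f ⁻¹' {r} = {x | x (j s) = c} \ f ⁻¹' {p} := by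
      ext x
      simp only [Set.mem_inter_iff, Set.mem_ofPred_eq, Set.mem_preimage, Set.mem_singleton_iff,
        Set.mem_sdiff]
      refine and_congr_right fun hx => ⟨fun h => h ▸ hrp, fun h => ?_⟩
      rcases hall (f x) with h3 | h3 | h3
      · exact h3
      · exact absurd h3 h
      · have h4 : x (j q) = b q := hjb q h3
        rw [hq, hbq, hx] at h4
        simp at h4
    have h5 : f ⁻¹' {p} ⊆ {x | x (j s) = c} := by
      have := hjb p
      rwa [hp, hbp] at this
    rw [h2, Set.ncard_sdiff h5, ncard_facet, (hf p).2]
  have h3 := (hf r).1.isDyadicPair (j s)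
  rwa [key s t false hst hall hrs rfl hs hj.symm ht,
    key t s true hst.symm (fun q => by have := hall q; tauto) hrt hj.symm ht rfl hs] at h3

/-- Colour `r` takes stacked initial segments in the two halves, and `s` and `t` take the
remainders. The total 2^(n+1) makes the deficits of `s` and `t` add up to `a r`. -/
theorem hasNestedColoring_of_isDyadicPair {n : ℕ} {a : Fin 3 → ℕ} (ha : ∀ t, a t ≤ 2 ^ n)
    (hsum : ∑ t, a t = 2 ^ (n + 1)) {s t : Fin 3} (hst : s ≠ t)
    (h : IsDyadicPair (2 ^ n - a s) (2 ^ n - a t)) : HasNestedColoring (n + 1) a := by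
  obtain ⟨r, hrs, hrt, hall⟩ := exists_third_color hst
  have hr : a r + a s + a t = 2 ^ (n + 1) := by
    rw [← hsum]
    have : (Finset.univ : Finset (Fin 3)) = {r, s, t} := by
      ext q; simpa using hall q
    rw [this, Finset.sum_insert (by simp [hrs, hrt]), Finset.sum_pair hst]; ring
  rw [pow_succ] at hr
  have h1 := ha s
  have h2 := ha t
  classical
  set F : (Fin (n + 1) → Bool) → Fin 3 := fun x =>
    if dropBit 0 x ∈ initialSegment n (bif x 0 then 2 ^ n - a t else 2 ^ n - a s) then r
    else bif x 0 then t else s with hF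
  have hFt : ∀ y, F (insertBit 0 true y) =
      if y ∈ initialSegment n (2 ^ n - a t) then r else t := fun y => by
    simp [hF, dropBit_insertBit]
  have hFs : ∀ y, F (insertBit 0 false y) =
      if y ∈ initialSegment n (2 ^ n - a s) then r else s := fun y => by
    simp [hF, dropBit_insertBit]
  have hpre : ∀ q, (insertBit 0 true ⁻¹' (F ⁻¹' {q})).ncard +
      (insertBit 0 false ⁻¹' (F ⁻¹' {q})).ncard = (F ⁻¹' {q}).ncard := fun q =>
    ncard_insertBit_add 0 true (F ⁻¹' {q})
  have hc : ∀ q, (initialSegment n (2 ^ n - a q))ᶜ.ncard + (2 ^ n - a q) = 2 ^ n := by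
    intro q
    have := ncard_add_ncard_compl_cube (initialSegment n (2 ^ n - a q))
    rw [ncard_initialSegment (by omega)] at this
    omega
  refine ⟨F, fun q => ?_⟩
  rcases hall q with rfl | rfl | rfl
  · constructor
    · convert isNested_of_isDyadicPair (n := n) (by omega) (by omega) h using 1
      ext x
      cases hx : x 0 <;> simp [hF, hx, Ne.symm hrs, Ne.symm hrt]
    · have h3 : insertBit 0 true ⁻¹' (F ⁻¹' {q}) = initialSegment n (2 ^ n - a t) := by
        ext y; simp [hFt, Ne.symm hrt]
      have h4 : insertBit 0 false ⁻¹' (F ⁻¹' {q}) = initialSegment n (2 ^ n - a s) := by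
        ext y; simp [hFs, Ne.symm hrs]
      have := hpre q
      rw [h3, h4, ncard_initialSegment (by omega), ncard_initialSegment (by omega)] at this
      omega
  · constructor
    · convert ((isNested_initialSegment n (2 ^ n - a q)).compl.cylinder 0).inter 0 false using 1
      ext x
      cases hx : x 0 <;> simp [hF, hx, hrs, Ne.symm hst, ite_eq_iff]
    · have h3 : insertBit 0 true ⁻¹' (F ⁻¹' {q}) = ∅ := by
        ext y; simp [hFt, Ne.symm hst, ite_eq_iff, hrs]
      have h4 : insertBit 0 false ⁻¹' (F ⁻¹' {q}) = (initialSegment n (2 ^ n - a q))ᶜ := by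
        ext y; simp [hFs, hrs]
      have := hpre q
      rw [h3, h4, Set.ncard_empty] at this
      have := hc q
      omega
  · constructor
    · convert ((isNested_initialSegment n (2 ^ n - a q)).compl.cylinder 0).inter 0 true using 1
      ext x
      cases hx : x 0 <;> simp [hF, hx, hrt, hst, ite_eq_iff]
    · have h3 : insertBit 0 false ⁻¹' (F ⁻¹' {q}) = ∅ := by
        ext y; simp [hFs, hst, ite_eq_iff, hrt]
      have h4 : insertBit 0 true ⁻¹' (F ⁻¹' {q}) = (initialSegment n (2 ^ n - a q))ᶜ := by
        ext y; simp [hFt, hrt]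
      have := hpre q
      rw [h3, h4, Set.ncard_empty] at this
      have := hc q
      omega

/-! ### Fit pairs as colourings -/

theorem exists_iso_union_iff {n a b : ℕ} (h : a + b ≤ 2 ^ n) :
    (∃ g₁ g₂ : hypercubeGraph n ≃g hypercubeGraph n,
      g₁ '' initialSegment n a ∪ g₂ '' initialSegment n b = initialSegment n (a + b)) ↔
    HasNestedColoring n ![a, b, 2 ^ n - (a + b)] := by
  have hca : (initialSegment n a).ncard = a := ncard_initialSegment (by omega)
  have hcb : (initialSegment n b).ncard = b := ncard_initialSegment (by omega)
  have hcab : (initialSegment n (a + b)).ncard = a + b := ncard_initialSegment h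
  classical
  constructor
  · rintro ⟨g₁, g₂, hg⟩
    set A := g₁ '' initialSegment n a with hA
    set B := g₂ '' initialSegment n b with hB
    have hAc : A.ncard = a := by rw [hA, Set.ncard_image_of_injective _ g₁.injective, hca]
    have hBc : B.ncard = b := by rw [hB, Set.ncard_image_of_injective _ g₂.injective, hcb]
    have hAn : IsNested A := (isNested_initialSegment n a).image_iso g₁
    have hBn : IsNested B := (isNested_initialSegment n b).image_iso g₂
    -- The union has exactly a + b points, which leaves no room for overlap.
    have hdis : A ∩ B = ∅ := by
      have h1 := Set.ncard_union_add_ncard_inter A B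
      rw [hg, hcab, hAc, hBc] at h1
      rw [← Set.ncard_eq_zero]; omega
    have hdis' : ∀ x ∈ B, x ∉ A := fun x hx hx' => by
      have : x ∈ A ∩ B := ⟨hx', hx⟩
      simp [hdis] at this
    set F : (Fin n → Bool) → Fin 3 := fun x => if x ∈ A then 0 else if x ∈ B then 1 else 2 with hF
    have h0 : F ⁻¹' {0} = A := by
      ext x; simp [hF, ite_eq_iff]
    have h1 : F ⁻¹' {1} = B := by
      ext x; simp only [hF, Set.mem_preimage, Set.mem_singleton_iff]
      by_cases hxB : x ∈ B
      · simp [hxB, hdis' x hxB]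
      · by_cases hxA : x ∈ A <;> simp [hxA, hxB]
    have h2 : F ⁻¹' {2} = (initialSegment n (a + b))ᶜ := by
      rw [← hg]
      ext x; simp only [hF, Set.mem_preimage, Set.mem_singleton_iff]
      by_cases hxB : x ∈ B <;> by_cases hxA : x ∈ A <;> simp [hxA, hxB]
    refine ⟨F, fun t => ?_⟩
    fin_cases t
    · exact ⟨by simpa [h0] using hAn, by simpa [h0] using hAc⟩
    · exact ⟨by simpa [h1] using hBn, by simpa [h1] using hBc⟩
    · have hn := (isNested_initialSegment n (a + b)).compl
      have := ncard_add_ncard_compl_cube (initialSegment n (a + b))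
      exact ⟨by simpa [h2] using hn, by simp only [Fin.reduceFinMk, h2]; simp; omega⟩
  · rintro ⟨f, hf⟩
    obtain ⟨h0, h0c⟩ := hf 0
    obtain ⟨h1, h1c⟩ := hf 1
    obtain ⟨h2, h2c⟩ := hf 2
    simp only [Matrix.cons_val] at h0c h1c h2c
    obtain ⟨g₁, hg₁⟩ := h0.exists_iso
    obtain ⟨g₂, hg₂⟩ := h1.exists_iso
    -- The union of the first two classes need not be an initial segment; undoing `g` makes it one.
    obtain ⟨g, hg⟩ := h2.compl.exists_iso
    have hc : (f ⁻¹' {2})ᶜ.ncard = a + b := by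
      have := ncard_add_ncard_compl_cube (f ⁻¹' {2})
      omega
    rw [hc] at hg
    rw [h0c] at hg₁
    rw [h1c] at hg₂
    refine ⟨g₁.trans g.symm, g₂.trans g.symm, ?_⟩
    have hu : f ⁻¹' {0} ∪ f ⁻¹' {1} = (f ⁻¹' {2})ᶜ := by
      ext x
      have : ∀ t : Fin 3, t = 0 ∨ t = 1 ↔ ¬ t = 2 := by decide
      simpa using this (f x)
    have hi : ∀ (g' : hypercubeGraph n ≃g hypercubeGraph n) (S : Set (Fin n → Bool)),
        g'.trans g.symm '' S = g.symm '' (g' '' S) := by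
      intro g' S; rw [Set.image_image]; rfl
    rw [hi, hi, ← Set.image_union, ← hg₁, ← hg₂, hu, hg, Set.image_image]
    simp

/-- The choice of cube is immaterial: passing from `m` to `m + 1` gives the third class at least 2^m
points, so a facet of it can be stripped off. -/
theorem isFit_iff_hasNestedColoring {n a b : ℕ} (h : a + b ≤ 2 ^ n) :
    IsFit a b ↔ HasNestedColoring n ![a, b, 2 ^ n - (a + b)] := by
  have step : ∀ m, a + b ≤ 2 ^ m → (HasNestedColoring (m + 1) ![a, b, 2 ^ (m + 1) - (a + b)] ↔
      HasNestedColoring m ![a, b, 2 ^ m - (a + b)]) := by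
    intro m hm
    rw [hasNestedColoring_succ_iff_update (t := 2) (by simp [pow_succ]; omega)]
    have : Function.update ![a, b, 2 ^ (m + 1) - (a + b)] 2
        (![a, b, 2 ^ (m + 1) - (a + b)] 2 - 2 ^ m) = ![a, b, 2 ^ m - (a + b)] := by
      funext t; fin_cases t <;> simp [pow_succ]; omega
    rw [this]
  have mono : ∀ m k, a + b ≤ 2 ^ m → (HasNestedColoring (m + k) ![a, b, 2 ^ (m + k) - (a + b)] ↔
      HasNestedColoring m ![a, b, 2 ^ m - (a + b)]) := by
    intro m k hm
    induction k with
    | zero => rfl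
    | succ k ih =>
      rw [← ih, ← add_assoc]
      exact step _ (hm.trans (Nat.pow_le_pow_right (by norm_num) (by omega)))
  constructor
  · intro hf
    exact (exists_iso_union_iff h).1 (hf n h)
  · intro hf m hm
    rw [exists_iso_union_iff hm]
    rcases le_total n m with hnm | hnm
    · obtain ⟨k, rfl⟩ := Nat.exists_eq_add_of_le hnm
      exact (mono n k h).2 hf
    · obtain ⟨k, rfl⟩ := Nat.exists_eq_add_of_le hnm
      exact (mono m k hm).1 hf

theorem hasNestedColoring_of_eq_zero {n : ℕ} {a : Fin 3 → ℕ} (hsum : ∑ t, a t = 2 ^ n)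
    {s t : Fin 3} (hst : s ≠ t) (hs : a s = 0) : HasNestedColoring n a := by
  obtain ⟨r, hrs, hrt, hall⟩ := exists_third_color hst
  have hr : a r + a s + a t = 2 ^ n := by
    rw [← hsum]
    have : (Finset.univ : Finset (Fin 3)) = {r, s, t} := by
      ext q; simpa using hall q
    rw [this, Finset.sum_insert (by simp [hrs, hrt]), Finset.sum_pair hst]; ring
  classical
  set F : (Fin n → Bool) → Fin 3 := fun x => if x ∈ initialSegment n (a r) then r else t with hF
  have hc : (initialSegment n (a r)).ncard = a r := ncard_initialSegment (by omega)
  refine ⟨F, fun q => ?_⟩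
  rcases hall q with rfl | rfl | rfl
  · have h1 : F ⁻¹' {q} = initialSegment n (a q) := by ext x; simp [hF, Ne.symm hrt]
    rw [h1]
    exact ⟨isNested_initialSegment n _, hc⟩
  · have h1 : F ⁻¹' {q} = ∅ := by ext x; simp [hF, ite_eq_iff, hrs, Ne.symm hst]
    rw [h1]
    exact ⟨IsNested.empty, by simp [hs]⟩
  · have h1 : F ⁻¹' {q} = (initialSegment n (a r))ᶜ := by ext x; simp [hF, hrt]
    rw [h1]
    have := ncard_add_ncard_compl_cube (initialSegment n (a r))
    exact ⟨(isNested_initialSegment n _).compl, by omega⟩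

/-! ### Recursion for the uncolourable pairs -/

open Classical in
/-- The pairs `(a, b)` such that `a`, `b` and `2 ^ n - (a + b)` are positive and are not the sizes
of the classes of a nested colouring of `Q_n`. -/
noncomputable def uncolorablePairs (n : ℕ) : Finset (ℕ × ℕ) :=
  (Finset.range (2 ^ n) ×ˢ Finset.range (2 ^ n)).filter fun p =>
    0 < p.1 ∧ 0 < p.2 ∧ p.1 + p.2 < 2 ^ n ∧ ¬ HasNestedColoring n ![p.1, p.2, 2 ^ n - (p.1 + p.2)]

open Classical in
/-- The pairs `(u, v)` such that `u`, `v` and `2 ^ n - (u + v)` are positive and no two of them form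
a dyadic pair. -/
noncomputable def nonDyadicPairs (n : ℕ) : Finset (ℕ × ℕ) :=
  (Finset.range (2 ^ n) ×ˢ Finset.range (2 ^ n)).filter fun p =>
    0 < p.1 ∧ 0 < p.2 ∧ p.1 + p.2 < 2 ^ n ∧ ¬ IsDyadicPair p.1 p.2 ∧
      ¬ IsDyadicPair p.1 (2 ^ n - (p.1 + p.2)) ∧ ¬ IsDyadicPair p.2 (2 ^ n - (p.1 + p.2))

theorem mem_uncolorablePairs {n a b : ℕ} : (a, b) ∈ uncolorablePairs n ↔
    0 < a ∧ 0 < b ∧ a + b < 2 ^ n ∧ ¬ HasNestedColoring n ![a, b, 2 ^ n - (a + b)] := by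
  simp only [uncolorablePairs, Finset.mem_filter, Finset.mem_product, Finset.mem_range]
  exact ⟨fun h => h.2, fun h => ⟨⟨by omega, by omega⟩, h⟩⟩

theorem mem_nonDyadicPairs {n u v : ℕ} : (u, v) ∈ nonDyadicPairs n ↔
    0 < u ∧ 0 < v ∧ u + v < 2 ^ n ∧ ¬ IsDyadicPair u v ∧
      ¬ IsDyadicPair u (2 ^ n - (u + v)) ∧ ¬ IsDyadicPair v (2 ^ n - (u + v)) := by
  simp only [nonDyadicPairs, Finset.mem_filter, Finset.mem_product, Finset.mem_range]
  exact ⟨fun h => h.2, fun h => ⟨⟨by omega, by omega⟩, h⟩⟩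

/-- The alternatives correspond to a large third, first or second class, or no large class. Overlaps
at size exactly 2^n are harmless: stripping then leaves an empty class, and such sizes are always
colourable. -/
theorem not_hasNestedColoring_succ_iff {n a b : ℕ} (h : a + b ≤ 2 ^ (n + 1)) :
    ¬ HasNestedColoring (n + 1) ![a, b, 2 ^ (n + 1) - (a + b)] ↔
      (a, b) ∈ uncolorablePairs n ∨ (2 ^ n ≤ a ∧ (a - 2 ^ n, b) ∈ uncolorablePairs n) ∨
      (2 ^ n ≤ b ∧ (a, b - 2 ^ n) ∈ uncolorablePairs n) ∨
      (a ≤ 2 ^ n ∧ b ≤ 2 ^ n ∧ (2 ^ n - a, 2 ^ n - b) ∈ nonDyadicPairs n) := by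
  have hp : 2 ^ (n + 1) = 2 * 2 ^ n := by rw [pow_succ]; ring
  have key : ∀ a b c : ℕ, a + b + c = 2 ^ n → (¬ HasNestedColoring n ![a, b, c] ↔
      0 < a ∧ 0 < b ∧ 0 < c ∧ ¬ HasNestedColoring n ![a, b, c]) := by
    intro a b c hsum
    have hs : ∑ t, ![a, b, c] t = 2 ^ n := by simpa [Fin.sum_univ_three] using hsum
    refine ⟨fun h => ⟨?_, ?_, ?_, h⟩, fun h => h.2.2.2⟩ <;>
      refine Nat.pos_of_ne_zero fun h0 => h ?_
    · exact hasNestedColoring_of_eq_zero hs (s := 0) (t := 1) (by decide) h0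
    · exact hasNestedColoring_of_eq_zero hs (s := 1) (t := 0) (by decide) h0
    · exact hasNestedColoring_of_eq_zero hs (s := 2) (t := 0) (by decide) h0
  simp only [mem_uncolorablePairs, mem_nonDyadicPairs]
  by_cases hc : a + b ≤ 2 ^ n
  · rw [hasNestedColoring_succ_iff_update (t := 2) (by simp; omega)]
    have : Function.update ![a, b, 2 ^ (n + 1) - (a + b)] 2
        (![a, b, 2 ^ (n + 1) - (a + b)] 2 - 2 ^ n) = ![a, b, 2 ^ n - (a + b)] := by
      funext t; fin_cases t <;> simp; omega
    rw [this]
    refine (key _ _ _ (by omega)).trans ?_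
    constructor
    · rintro ⟨h1, h2, h3, h4⟩
      exact Or.inl ⟨h1, h2, by omega, h4⟩
    · rintro (⟨h1, h2, h3, h4⟩ | h1 | h1 | h1)
      · exact ⟨h1, h2, by omega, h4⟩
      all_goals omega
  by_cases ha : 2 ^ n ≤ a
  · rw [hasNestedColoring_succ_iff_update (t := 0) (by simpa using ha)]
    have : Function.update ![a, b, 2 ^ (n + 1) - (a + b)] 0
        (![a, b, 2 ^ (n + 1) - (a + b)] 0 - 2 ^ n) =
          ![a - 2 ^ n, b, 2 ^ n - (a - 2 ^ n + b)] := by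
      funext t; fin_cases t <;> simp; omega
    rw [this]
    refine (key _ _ _ (by omega)).trans ?_
    constructor
    · rintro ⟨h1, h2, h3, h4⟩
      exact Or.inr (Or.inl ⟨ha, h1, h2, by omega, h4⟩)
    · rintro (h1 | ⟨_, h1, h2, h3, h4⟩ | h1 | h1)
      · omega
      · exact ⟨h1, h2, by omega, h4⟩
      all_goals omega
  by_cases hb : 2 ^ n ≤ b
  · rw [hasNestedColoring_succ_iff_update (t := 1) (by simpa using hb)]
    have : Function.update ![a, b, 2 ^ (n + 1) - (a + b)] 1
        (![a, b, 2 ^ (n + 1) - (a + b)] 1 - 2 ^ n) =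
          ![a, b - 2 ^ n, 2 ^ n - (a + (b - 2 ^ n))] := by
      funext t; fin_cases t <;> simp; omega
    rw [this]
    refine (key _ _ _ (by omega)).trans ?_
    constructor
    · rintro ⟨h1, h2, h3, h4⟩
      exact Or.inr (Or.inr (Or.inl ⟨hb, h1, h2, by omega, h4⟩))
    · rintro (h1 | h1 | ⟨_, h1, h2, h3, h4⟩ | h1)
      · omega
      · omega
      · exact ⟨h1, h2, by omega, h4⟩
      · omega
  have hle : ∀ t, ![a, b, 2 ^ (n + 1) - (a + b)] t ≤ 2 ^ n := by
    intro t; fin_cases t <;> simp <;> omega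
  have hsum : ∑ t, ![a, b, 2 ^ (n + 1) - (a + b)] t = 2 ^ (n + 1) := by
    simp [Fin.sum_univ_three]; omega
  -- The three deficits sum to 2^n, so the third is determined by the other two.
  have hw : 2 ^ n - (2 ^ (n + 1) - (a + b)) = 2 ^ n - (2 ^ n - a + (2 ^ n - b)) := by omega
  have hiff : HasNestedColoring (n + 1) ![a, b, 2 ^ (n + 1) - (a + b)] ↔
      IsDyadicPair (2 ^ n - a) (2 ^ n - b) ∨
      IsDyadicPair (2 ^ n - a) (2 ^ n - (2 ^ n - a + (2 ^ n - b))) ∨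
      IsDyadicPair (2 ^ n - b) (2 ^ n - (2 ^ n - a + (2 ^ n - b))) := by
    rw [← hw]
    constructor
    · intro hcol
      obtain ⟨s, t, hst, hd⟩ := hcol.exists_isDyadicPair hle
      fin_cases s <;> fin_cases t <;> simp only [Fin.reduceFinMk, ne_eq, not_true_eq_false] at hst <;>
        simp only [Fin.zero_eta, Fin.mk_one, Fin.reduceFinMk, Matrix.cons_val] at hd <;>
        first | exact absurd rfl hst | tauto | (have := hd.symm; tauto)
    · rintro (hd | hd | hd)
      · exact hasNestedColoring_of_isDyadicPair hle hsum (s := 0) (t := 1) (by decide) hd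
      · exact hasNestedColoring_of_isDyadicPair hle hsum (s := 0) (t := 2) (by decide) hd
      · exact hasNestedColoring_of_isDyadicPair hle hsum (s := 1) (t := 2) (by decide) hd
  rw [hiff]
  constructor
  · intro hn
    push Not at hn
    exact Or.inr (Or.inr (Or.inr ⟨by omega, by omega, by omega, by omega, by omega, hn⟩))
  · rintro (h1 | h1 | h1 | ⟨_, _, _, _, _, h1⟩)
    · omega
    · omega
    · omega
    · tauto

/-- Fitness can be tested in Q_{n+1}. With a, b ≤ 2^n, the cases of a large first or second class
would leave an empty class, so they contribute nothing. -/
theorem unfitPairs_eq (n : ℕ) : unfitPairs n = ↑(uncolorablePairs n ∪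
    (nonDyadicPairs n).image fun p => (2 ^ n - p.1, 2 ^ n - p.2)) := by
  have hp : 2 ^ (n + 1) = 2 * 2 ^ n := by rw [pow_succ]; ring
  ext ⟨a, b⟩
  simp only [unfitPairs, Set.mem_ofPred_eq, Finset.coe_union, Finset.coe_image, Set.mem_union,
    Set.mem_image, SetLike.mem_coe, Prod.exists, Prod.mk.injEq]
  constructor
  · rintro ⟨⟨ha, ha'⟩, ⟨hb, hb'⟩, h⟩
    rw [isFit_iff_hasNestedColoring (n := n + 1) (by omega),
      not_hasNestedColoring_succ_iff (by omega)] at h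
    rcases h with h | ⟨h0, h⟩ | ⟨h0, h⟩ | ⟨_, _, h⟩
    · exact Or.inl h
    · rw [mem_uncolorablePairs] at h; omega
    · rw [mem_uncolorablePairs] at h; omega
    · exact Or.inr ⟨_, _, h, by omega, by omega⟩
  · rintro (h | ⟨u, v, h, rfl, rfl⟩)
    · have h1 := mem_uncolorablePairs.1 h
      refine ⟨by omega, by omega, ?_⟩
      rw [isFit_iff_hasNestedColoring (n := n + 1) (by omega),
        not_hasNestedColoring_succ_iff (by omega)]
      exact Or.inl h
    · have h1 := mem_nonDyadicPairs.1 h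
      refine ⟨by omega, by omega, ?_⟩
      rw [isFit_iff_hasNestedColoring (n := n + 1) (by omega),
        not_hasNestedColoring_succ_iff (by omega)]
      refine Or.inr (Or.inr (Or.inr ⟨by omega, by omega, ?_⟩))
      rwa [Nat.sub_sub_self (by omega), Nat.sub_sub_self (by omega)]

theorem unfitCount_eq_add (n : ℕ) :
    unfitCount n = (uncolorablePairs n).card + (nonDyadicPairs n).card := by
  rw [unfitCount, unfitPairs_eq, Set.ncard_coe_finset, Finset.card_union_of_disjoint,
    Finset.card_image_of_injOn]
  · rintro ⟨u, v⟩ h ⟨u', v'⟩ h' he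
    have h1 := mem_nonDyadicPairs.1 h
    have h2 := mem_nonDyadicPairs.1 h'
    simp only [Prod.mk.injEq] at he ⊢
    omega
  · rw [Finset.disjoint_left]
    rintro ⟨a, b⟩ h h'
    obtain ⟨⟨u, v⟩, h2, h3⟩ := Finset.mem_image.1 h'
    have h1 := mem_uncolorablePairs.1 h
    have h4 := mem_nonDyadicPairs.1 h2
    simp only [Prod.mk.injEq] at h3
    omega

/-- A large third class or no large class gives the unfit pairs of level `n`; a large first or
second class gives one shifted copy of the uncolourable pairs each. -/
theorem card_uncolorablePairs_succ (n : ℕ) :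
    (uncolorablePairs (n + 1)).card = unfitCount n + 2 * (uncolorablePairs n).card := by
  have hp : 2 ^ (n + 1) = 2 * 2 ^ n := by rw [pow_succ]; ring
  have hU : (↑(uncolorablePairs (n + 1)) : Set (ℕ × ℕ)) = unfitPairs n ∪
      ↑((uncolorablePairs n).image fun p => (p.1 + 2 ^ n, p.2)) ∪
      ↑((uncolorablePairs n).image fun p => (p.1, p.2 + 2 ^ n)) := by
    rw [unfitPairs_eq]
    ext ⟨a, b⟩
    simp only [← Finset.coe_union, SetLike.mem_coe, Finset.mem_union, Finset.mem_image,
      Prod.exists, Prod.mk.injEq]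
    rw [mem_uncolorablePairs]
    constructor
    · rintro ⟨h1, h2, h3, h⟩
      rw [not_hasNestedColoring_succ_iff (by omega)] at h
      rcases h with h | ⟨h0, h⟩ | ⟨h0, h⟩ | ⟨_, _, h⟩
      · exact Or.inl (Or.inl (Or.inl h))
      · exact Or.inl (Or.inr ⟨_, _, h, by omega, rfl⟩)
      · exact Or.inr ⟨_, _, h, rfl, by omega⟩
      · exact Or.inl (Or.inl (Or.inr ⟨_, _, h, by omega, by omega⟩))
    · rintro (((h | ⟨u, v, h, rfl, rfl⟩) | ⟨u, v, h, rfl, rfl⟩) | ⟨u, v, h, rfl, rfl⟩)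
      · have h1 := mem_uncolorablePairs.1 h
        refine ⟨by omega, by omega, by omega, ?_⟩
        rw [not_hasNestedColoring_succ_iff (by omega)]
        exact Or.inl h
      · have h1 := mem_nonDyadicPairs.1 h
        refine ⟨by omega, by omega, by omega, ?_⟩
        rw [not_hasNestedColoring_succ_iff (by omega)]
        refine Or.inr (Or.inr (Or.inr ⟨by omega, by omega, ?_⟩))
        rwa [Nat.sub_sub_self (by omega), Nat.sub_sub_self (by omega)]
      · have h1 := mem_uncolorablePairs.1 h
        refine ⟨by omega, by omega, by omega, ?_⟩
        rw [not_hasNestedColoring_succ_iff (by omega)]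
        exact Or.inr (Or.inl ⟨by omega, by simpa using h⟩)
      · have h1 := mem_uncolorablePairs.1 h
        refine ⟨by omega, by omega, by omega, ?_⟩
        rw [not_hasNestedColoring_succ_iff (by omega)]
        exact Or.inr (Or.inr (Or.inl ⟨by omega, by simpa using h⟩))
  have hfin : (unfitPairs n).Finite := by rw [unfitPairs_eq]; exact Finset.finite_toSet _
  rw [← Set.ncard_coe_finset, hU, Set.ncard_union_eq _ (hfin.union (Finset.finite_toSet _))
    (Finset.finite_toSet _), Set.ncard_union_eq _ hfin (Finset.finite_toSet _),
    Set.ncard_coe_finset, Set.ncard_coe_finset, Finset.card_image_of_injective,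
    Finset.card_image_of_injective, unfitCount]
  · ring
  · rintro ⟨u, v⟩ ⟨u', v'⟩ he
    simp only [Prod.mk.injEq] at he ⊢; omega
  · rintro ⟨u, v⟩ ⟨u', v'⟩ he
    simp only [Prod.mk.injEq] at he ⊢; omega
  · rw [Set.disjoint_left]
    rintro ⟨a, b⟩ h h'
    obtain ⟨⟨u, v⟩, h2, h3⟩ := Finset.mem_image.1 (Finset.mem_coe.1 h')
    have h4 := mem_uncolorablePairs.1 h2
    simp only [unfitPairs, Set.mem_ofPred_eq] at h
    simp only [Prod.mk.injEq] at h3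
    omega
  · rw [Set.disjoint_left]
    rintro ⟨a, b⟩ h h'
    obtain ⟨⟨u, v⟩, h2, h3⟩ := Finset.mem_image.1 (Finset.mem_coe.1 h')
    have h4 := mem_uncolorablePairs.1 h2
    simp only [Prod.mk.injEq] at h3
    rcases h with h | h
    · simp only [unfitPairs, Set.mem_ofPred_eq] at h
      omega
    · obtain ⟨⟨u', v'⟩, h5, h6⟩ := Finset.mem_image.1 (Finset.mem_coe.1 h)
      have h7 := mem_uncolorablePairs.1 h5
      simp only [Prod.mk.injEq] at h6
      omega

theorem uncolorablePairs_zero : uncolorablePairs 0 = ∅ := by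
  ext ⟨a, b⟩
  rw [mem_uncolorablePairs]
  simp; omega

/-! ### Arithmetic of dyadic pairs by parity -/

theorem isDyadicPair_two_mul {u v : ℕ} : IsDyadicPair (2 * u) (2 * v) ↔ IsDyadicPair u v := by
  constructor
  · rintro ⟨k, h1, h2, h3⟩
    cases k with
    | zero => exact ⟨0, by simp, by omega, by omega⟩
    | succ k =>
      rw [pow_succ'] at h1 h2 h3
      exact ⟨k, h1.imp (Nat.dvd_of_mul_dvd_mul_left two_pos)
        (Nat.dvd_of_mul_dvd_mul_left two_pos), by omega, by omega⟩
  · rintro ⟨k, h1, h2, h3⟩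
    refine ⟨k + 1, ?_, ?_, ?_⟩
    · rw [pow_succ']
      exact h1.imp (Nat.mul_dvd_mul_left 2) (Nat.mul_dvd_mul_left 2)
    · rw [pow_succ']; omega
    · rw [pow_succ']; omega

theorem eq_zero_of_two_pow_dvd_odd {k u : ℕ} (hu : u % 2 = 1) (h : 2 ^ k ∣ u) : k = 0 := by
  by_contra hk
  have := (dvd_pow_self 2 hk).trans h
  omega

theorem isDyadicPair_odd_odd {u v : ℕ} (hu : u % 2 = 1) (hv : v % 2 = 1) :
    IsDyadicPair u v ↔ u = v := by
  constructor
  · rintro ⟨k, h1, h2, h3⟩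
    obtain rfl : k = 0 := h1.elim (eq_zero_of_two_pow_dvd_odd hu) (eq_zero_of_two_pow_dvd_odd hv)
    omega
  · rintro rfl
    exact ⟨0, by simp, by omega, by omega⟩

theorem le_of_two_pow_dvd_mul_odd {k l p : ℕ} (h : 2 ^ l ∣ 2 ^ k * (2 * p + 1)) : l ≤ k := by
  have hc : Nat.Coprime (2 ^ l) (2 * p + 1) := Nat.Coprime.pow_left l (by simp)
  exact (Nat.pow_dvd_pow_iff_le_right (by norm_num)).1 (hc.dvd_of_dvd_mul_right h)

/-- Scales up to 2^(k+1) are the only possible ones, and the largest is the weakest condition: `u`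
is within 2^(k+1) of the even number. The extreme values are multiples of 2^(k+2), so an odd `u`
lies strictly between them. -/
theorem isDyadicPair_odd_iff {u k p : ℕ} (hu : u % 2 = 1) :
    IsDyadicPair u (2 ^ (k + 1) * (2 * p + 1)) ↔ u / 2 ^ (k + 2) = p := by
  have hp : 2 ^ (k + 2) = 2 * 2 ^ (k + 1) := by ring
  have hpos := Nat.two_pow_pos (k + 1)
  have hev : 2 ^ (k + 1) % 2 = 0 := by rw [pow_succ]; omega
  rw [Nat.div_eq_iff (by positivity), hp]
  set P := 2 ^ (k + 1) with hP
  have hm : P * (2 * p + 1) = 2 * (p * P) + P := by ring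
  have hm2 : p * (2 * P) = 2 * (p * P) := by ring
  rw [hm, hm2]
  constructor
  · rintro ⟨l, h1, h2, h3⟩
    have hl : 2 ^ l ≤ P := by
      rcases h1 with h1 | h1
      · rw [eq_zero_of_two_pow_dvd_odd hu h1]; simp; omega
      · rw [← hm] at h1
        exact Nat.pow_le_pow_right (by norm_num) (le_of_two_pow_dvd_mul_odd h1)
    omega
  · intro h
    exact ⟨k + 1, Or.inr (by rw [← hm]; exact Dvd.intro _ rfl), by omega, by omega⟩

/-! ### Counting triples with two odd members -/

/-- The pairs of odd numbers with sum less than `2 ^ n`. -/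
def oddPairs (n : ℕ) : Finset (ℕ × ℕ) :=
  (Finset.range (2 ^ n) ×ˢ Finset.range (2 ^ n)).filter fun p =>
    p.1 % 2 = 1 ∧ p.2 % 2 = 1 ∧ p.1 + p.2 < 2 ^ n

theorem mem_oddPairs {n u v : ℕ} :
    (u, v) ∈ oddPairs n ↔ u % 2 = 1 ∧ v % 2 = 1 ∧ u + v < 2 ^ n := by
  simp only [oddPairs, Finset.mem_filter, Finset.mem_product, Finset.mem_range]
  exact ⟨fun h => h.2, fun h => ⟨⟨by omega, by omega⟩, h⟩⟩

/-- Half the sum and half the first entry, rounded down, encode the pair as some j < s < 2^n. -/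
theorem card_oddPairs (n : ℕ) : (oddPairs (n + 1)).card * 2 = 2 ^ n * (2 ^ n - 1) := by
  rw [← Finset.sum_range_id_mul_two]
  congr 1
  have : ∑ i ∈ Finset.range (2 ^ n), i =
      ((Finset.range (2 ^ n)).sigma fun s => Finset.range s).card := by simp
  rw [this]
  have hp : 2 ^ (n + 1) = 2 * 2 ^ n := by ring
  refine Finset.card_bij' (fun p _ => ⟨(p.1 + p.2) / 2, p.1 / 2⟩)
    (fun q _ => (2 * q.2 + 1, 2 * (q.1 - q.2) - 1)) ?_ ?_ ?_ ?_
  · rintro ⟨u, v⟩ h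
    rw [mem_oddPairs] at h
    simp only [Finset.mem_sigma, Finset.mem_range]; omega
  · rintro ⟨s, j⟩ h
    simp only [Finset.mem_sigma, Finset.mem_range] at h
    rw [mem_oddPairs]; dsimp only; omega
  · rintro ⟨u, v⟩ h
    rw [mem_oddPairs] at h
    simp only [Prod.mk.injEq]; omega
  · rintro ⟨s, j⟩ h
    simp only [Finset.mem_sigma, Finset.mem_range] at h
    dsimp only at h ⊢
    have h1 : (2 * j + 1 + (2 * (s - j) - 1)) / 2 = s := by omega
    have h2 : (2 * j + 1) / 2 = j := by omega
    simp only [h1, h2]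

theorem exists_eq_two_pow_mul {w : ℕ} (h0 : 0 < w) (h : w % 2 = 0) :
    ∃ k p, w = 2 ^ (k + 1) * (2 * p + 1) := by
  obtain ⟨k, m, hm, rfl⟩ := Nat.exists_eq_two_pow_mul_odd h0.ne'
  obtain ⟨p, rfl⟩ := hm
  cases k with
  | zero => simp at h
  | succ k => exact ⟨k, p, rfl⟩

theorem two_pow_mul_odd_inj {k l p q : ℕ} (h : 2 ^ k * (2 * p + 1) = 2 ^ l * (2 * q + 1)) :
    k = l :=
  le_antisymm (le_of_two_pow_dvd_mul_odd (Dvd.intro _ h))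
    (le_of_two_pow_dvd_mul_odd (Dvd.intro _ h.symm))

/-- For `u < 2 ^ (n + 1)` and `k ≤ n` the odd multiple of `2 ^ (k + 1)` nearest to `u` is at most
`2 ^ (n + 1)`. -/
theorem two_pow_mul_div_le {n u k : ℕ} (hu : u < 2 ^ (n + 1)) (hk : k ≤ n) :
    2 ^ (k + 1) * (2 * (u / 2 ^ (k + 2)) + 1) ≤ 2 ^ (n + 1) := by
  obtain ⟨d, rfl⟩ := Nat.exists_eq_add_of_le hk
  cases d with
  | zero =>
    have : u / 2 ^ (k + 2) = 0 := Nat.div_eq_of_lt (hu.trans (by gcongr <;> omega))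
    simp [this]
  | succ d =>
    have h1 : 2 ^ (k + (d + 1) + 1) = 2 ^ d * 2 ^ (k + 2) := by ring
    have h2 : u / 2 ^ (k + 2) < 2 ^ d := by
      rw [Nat.div_lt_iff_lt_mul (by positivity)]; omega
    calc _ ≤ 2 ^ (k + 1) * (2 * 2 ^ d) := Nat.mul_le_mul_left _ (by omega)
      _ = _ := by ring

open Classical in
-- Each odd u < 2^(n+1) and each valuation k + 1 with k ≤ n determine one even partner, hence one
-- `v`. That is 2^n choices of `u` times n + 1 of `k`.
theorem card_oddPairs_left (n : ℕ) :
    ((oddPairs (n + 2)).filter fun p => IsDyadicPair p.1 (2 ^ (n + 2) - (p.1 + p.2))).card =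
      (n + 1) * 2 ^ n := by
  have h4 : 2 ^ (n + 2) = 4 * 2 ^ n := by ring
  have h2 : 2 ^ (n + 1) = 2 * 2 ^ n := by ring
  have : (n + 1) * 2 ^ n = (Finset.range (n + 1) ×ˢ Finset.range (2 ^ n)).card := by simp
  rw [this]
  symm
  have hev : ∀ k m : ℕ, 2 ^ (k + 1) * m % 2 = 0 := fun k m => by
    rw [pow_succ, mul_assoc, mul_left_comm]; omega
  have hq : ∀ q ∈ Finset.range (n + 1) ×ˢ Finset.range (2 ^ n),
      2 ^ (q.1 + 1) * (2 * ((2 * q.2 + 1) / 2 ^ (q.1 + 2)) + 1) ≤ 2 ^ (n + 1) ∧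
      2 * q.2 + 1 < 2 ^ (n + 1) := by
    rintro ⟨k, i⟩ h
    simp only [Finset.mem_product, Finset.mem_range] at h ⊢
    exact ⟨two_pow_mul_div_le (by omega) (by omega), by omega⟩
  refine Finset.card_bij (fun q _ => (2 * q.2 + 1, 2 ^ (n + 2) - (2 * q.2 + 1 +
    2 ^ (q.1 + 1) * (2 * ((2 * q.2 + 1) / 2 ^ (q.1 + 2)) + 1)))) ?_ ?_ ?_
  · intro q h
    obtain ⟨hw, hu⟩ := hq q h
    have he := hev q.1 (2 * ((2 * q.2 + 1) / 2 ^ (q.1 + 2)) + 1)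
    rw [Finset.mem_filter, mem_oddPairs]
    refine ⟨⟨by omega, by omega, ?_⟩, ?_⟩
    · have : 0 < 2 ^ (q.1 + 1) * (2 * ((2 * q.2 + 1) / 2 ^ (q.1 + 2)) + 1) := by positivity
      omega
    · dsimp only
      rw [show 2 ^ (n + 2) - (2 * q.2 + 1 + (2 ^ (n + 2) - (2 * q.2 + 1 +
        2 ^ (q.1 + 1) * (2 * ((2 * q.2 + 1) / 2 ^ (q.1 + 2)) + 1)))) =
        2 ^ (q.1 + 1) * (2 * ((2 * q.2 + 1) / 2 ^ (q.1 + 2)) + 1) by omega,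
        isDyadicPair_odd_iff (by omega)]
  · rintro ⟨k, i⟩ h ⟨k', i'⟩ h' he
    have h1 := hq _ h
    have h1' := hq _ h'
    simp only [Prod.mk.injEq] at he h1 h1' ⊢
    obtain rfl : i = i' := by omega
    refine ⟨?_, rfl⟩
    have := two_pow_mul_odd_inj (k := k + 1) (l := k' + 1) (by omega :
      2 ^ (k + 1) * (2 * ((2 * i + 1) / 2 ^ (k + 2)) + 1) =
        2 ^ (k' + 1) * (2 * ((2 * i + 1) / 2 ^ (k' + 2)) + 1))
    omega
  · rintro ⟨u, v⟩ h
    rw [Finset.mem_filter, mem_oddPairs] at h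
    obtain ⟨⟨hu, hv, huv⟩, hd⟩ := h
    dsimp only at hd
    obtain ⟨k, p, hw⟩ := exists_eq_two_pow_mul (w := 2 ^ (n + 2) - (u + v)) (by omega) (by omega)
    rw [hw, isDyadicPair_odd_iff hu] at hd
    have hdm := Nat.div_mul_le_self u (2 ^ (k + 2))
    have hlt := Nat.lt_div_mul_add (a := u) (b := 2 ^ (k + 2)) (by positivity)
    rw [hd] at hdm hlt
    have e1 : p * 2 ^ (k + 2) = 2 * (2 ^ (k + 1) * p) := by ring
    have e2 : 2 ^ (k + 2) = 2 * 2 ^ (k + 1) := by ring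
    have e3 : 2 ^ (k + 1) * (2 * p + 1) = 2 * (2 ^ (k + 1) * p) + 2 ^ (k + 1) := by ring
    have hk : k + 1 < n + 2 := by
      refine (Nat.pow_lt_pow_iff_right (a := 2) (by norm_num)).1 ?_
      omega
    -- A larger `u` would have its nearest odd multiple at or above 2^(n+1), leaving nothing for
    -- `v`.
    have hu2 : u < 2 * 2 ^ n := by
      obtain ⟨d, rfl⟩ := Nat.exists_eq_add_of_le (show k ≤ n by omega)
      have e4 : 4 * 2 ^ (k + d) = 2 ^ (k + 1) * (2 * 2 ^ d) := by ring
      by_contra hcon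
      have h5 : 2 ^ (k + 1) * (2 ^ d) < 2 ^ (k + 1) * (2 * p + 2) := by
        have : 2 ^ (k + 1) * (2 ^ d) = 2 * 2 ^ (k + d) := by ring
        have : 2 ^ (k + 1) * (2 * p + 2) = 2 * (2 ^ (k + 1) * p) + 2 * 2 ^ (k + 1) := by ring
        omega
      have h6 := Nat.lt_of_mul_lt_mul_left h5
      have h7 : 2 ^ (k + 1) * (2 ^ d) ≤ 2 ^ (k + 1) * (2 * p + 1) := Nat.mul_le_mul_left _ (by omega)
      have : 2 ^ (k + 1) * (2 ^ d) = 2 * 2 ^ (k + d) := by ring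
      omega
    refine ⟨(k, u / 2), ?_, ?_⟩
    · simp only [Finset.mem_product, Finset.mem_range]; omega
    · have h7 : 2 * (u / 2) + 1 = u := by omega
      simp only [Prod.mk.injEq, h7, hd, ← hw, true_and]
      omega

open Classical in
theorem card_oddPairs_right (n : ℕ) :
    ((oddPairs (n + 2)).filter fun p => IsDyadicPair p.2 (2 ^ (n + 2) - (p.1 + p.2))).card =
      (n + 1) * 2 ^ n := by
  rw [← card_oddPairs_left]
  refine Finset.card_bij' (fun p _ => p.swap) (fun p _ => p.swap) ?_ ?_ ?_ ?_
  · rintro ⟨u, v⟩ h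
    rw [Finset.mem_filter, mem_oddPairs] at h
    rw [Prod.swap, Finset.mem_filter, mem_oddPairs]
    refine ⟨by omega, ?_⟩
    simpa [add_comm] using h.2
  · rintro ⟨u, v⟩ h
    rw [Finset.mem_filter, mem_oddPairs] at h
    rw [Prod.swap, Finset.mem_filter, mem_oddPairs]
    refine ⟨by omega, ?_⟩
    simpa [add_comm] using h.2
  · simp
  · simp

theorem card_oddPairs_diag (n : ℕ) :
    ((oddPairs (n + 2)).filter fun p => p.1 = p.2).card = 2 ^ n := by
  have h4 : 2 ^ (n + 2) = 4 * 2 ^ n := by ring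
  rw [← Finset.card_range (2 ^ n)]
  refine Finset.card_bij' (fun p _ => p.1 / 2) (fun i _ => (2 * i + 1, 2 * i + 1)) ?_ ?_ ?_ ?_
  · rintro ⟨u, v⟩ h
    rw [Finset.mem_filter, mem_oddPairs] at h
    simp only [Finset.mem_range]; omega
  · intro i h
    simp only [Finset.mem_range] at h
    rw [Finset.mem_filter, mem_oddPairs]; omega
  · rintro ⟨u, v⟩ h
    rw [Finset.mem_filter, mem_oddPairs] at h
    simp only [Prod.mk.injEq]; omega
  · intro i h; simp only; omega

theorem two_pow_succ_mod_six (j : ℕ) : 2 ^ (j + 1) % 6 = 2 ∨ 2 ^ (j + 1) % 6 = 4 := by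
  induction j with
  | zero => simp
  | succ j ih => rw [pow_succ]; omega

open Classical in
-- Let w = 2^(k+1) (2p+1) be the even member. Both odd members lie within 2^(k+1) of it, so
-- 2^(n+1-k) is strictly between 6p + 1 and 6p + 5. Being 2 or 4 mod 6, it determines `p`. The odd
-- members are then a common base plus two positive odd numbers with sum 2^(k+1), which gives 2^k
-- choices.
theorem card_oddPairs_left_right (n : ℕ) :
    ((oddPairs (n + 2)).filter fun p => IsDyadicPair p.1 (2 ^ (n + 2) - (p.1 + p.2)) ∧
      IsDyadicPair p.2 (2 ^ (n + 2) - (p.1 + p.2))).card = 2 ^ (n + 1) - 1 := by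
  have : 2 ^ (n + 1) - 1 = ((Finset.range (n + 1)).sigma fun k => Finset.range (2 ^ k)).card := by
    simp [Nat.geomSum_eq]
  rw [this]
  symm
  -- `P k` is the forced `p`, and `e k` records whether the residue mod 6 is 2 or 4.
  have hex : ∀ k ∈ Finset.range (n + 1), ∃ p e, 2 ^ (n + 1 - k) = 6 * p + 2 + 2 * e ∧ e ≤ 1 := by
    intro k hk
    rw [Finset.mem_range] at hk
    obtain ⟨j, hj⟩ : ∃ j, n + 1 - k = j + 1 := ⟨n - k, by omega⟩
    rw [hj]
    have := two_pow_succ_mod_six j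
    exact ⟨2 ^ (j + 1) / 6, (2 ^ (j + 1) % 6 - 2) / 2, by omega, by omega⟩
  choose! P e hPe he using hex
  have hN : ∀ k ∈ Finset.range (n + 1), 2 ^ (n + 2) =
      6 * (2 ^ (k + 1) * P k) + 2 * 2 ^ (k + 1) + 2 * (2 ^ (k + 1) * e k) := by
    intro k hk
    have h1 := hPe k hk
    rw [Finset.mem_range] at hk
    rw [show n + 2 = (k + 1) + (n + 1 - k) by omega, pow_add, h1]; ring
  have heP : ∀ k ∈ Finset.range (n + 1),
      2 ^ (k + 1) * e k = 0 ∨ 2 ^ (k + 1) * e k = 2 ^ (k + 1) := by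
    intro k hk
    have := he k hk
    obtain h | h : e k = 0 ∨ e k = 1 := by omega
    · simp [h]
    · simp [h]
  have hw : ∀ k, 2 ^ (k + 1) * (2 * P k + 1) = 2 * (2 ^ (k + 1) * P k) + 2 ^ (k + 1) :=
    fun k => by ring
  refine Finset.card_bij (fun q _ =>
    (2 * (2 ^ (q.1 + 1) * P q.1) + 2 ^ (q.1 + 1) * e q.1 + (2 * q.2 + 1),
     2 * (2 ^ (q.1 + 1) * P q.1) + 2 ^ (q.1 + 1) * e q.1 + (2 ^ (q.1 + 1) - (2 * q.2 + 1))))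
    ?_ ?_ ?_
  · rintro ⟨k, i⟩ h
    simp only [Finset.mem_sigma] at h
    have h1 := hN k h.1
    have h2 := heP k h.1
    have h3 := Finset.mem_range.1 h.2
    have h4 : 2 ^ (k + 1) = 2 * 2 ^ k := by ring
    have h5 := hw k
    have h6 : 2 ^ (k + 2) = 2 * 2 ^ (k + 1) := by ring
    have h7 : P k * 2 ^ (k + 2) = 2 * (2 ^ (k + 1) * P k) := by ring
    have hu : (2 * (2 ^ (k + 1) * P k) + 2 ^ (k + 1) * e k + (2 * i + 1)) % 2 = 1 := by omega
    have hv : (2 * (2 ^ (k + 1) * P k) + 2 ^ (k + 1) * e k +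
        (2 ^ (k + 1) - (2 * i + 1))) % 2 = 1 := by omega
    rw [Finset.mem_filter, mem_oddPairs]
    dsimp only
    refine ⟨⟨hu, hv, by omega⟩, ?_⟩
    rw [show 2 ^ (n + 2) - (2 * (2 ^ (k + 1) * P k) + 2 ^ (k + 1) * e k + (2 * i + 1) +
      (2 * (2 ^ (k + 1) * P k) + 2 ^ (k + 1) * e k + (2 ^ (k + 1) - (2 * i + 1)))) =
      2 ^ (k + 1) * (2 * P k + 1) by omega, isDyadicPair_odd_iff hu, isDyadicPair_odd_iff hv,
      Nat.div_eq_iff (by positivity), Nat.div_eq_iff (by positivity), h7]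
    omega
  · rintro ⟨k, i⟩ h ⟨k', i'⟩ h' heq
    simp only [Finset.mem_sigma] at h h'
    have h1 := hN k h.1
    have h1' := hN k' h'.1
    have h3 := Finset.mem_range.1 h.2
    have h3' := Finset.mem_range.1 h'.2
    have h4 : 2 ^ (k + 1) = 2 * 2 ^ k := by ring
    have h4' : 2 ^ (k' + 1) = 2 * 2 ^ k' := by ring
    simp only [Prod.mk.injEq] at heq
    have h5 : 2 ^ (k + 1) * (2 * P k + 1) = 2 ^ (k' + 1) * (2 * P k' + 1) := by
      rw [hw, hw]; omega
    obtain rfl : k = k' := by simpa using two_pow_mul_odd_inj h5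
    obtain rfl : i = i' := by omega
    rfl
  · rintro ⟨u, v⟩ h
    rw [Finset.mem_filter, mem_oddPairs] at h
    obtain ⟨⟨hu, hv, huv⟩, hd, hd'⟩ := h
    dsimp only at hd hd'
    obtain ⟨k, p, hwk⟩ := exists_eq_two_pow_mul (w := 2 ^ (n + 2) - (u + v)) (by omega)
      (by rw [pow_succ]; omega)
    rw [hwk, isDyadicPair_odd_iff hu, Nat.div_eq_iff (by positivity)] at hd
    rw [hwk, isDyadicPair_odd_iff hv, Nat.div_eq_iff (by positivity)] at hd'
    have e1 : p * 2 ^ (k + 2) = 2 * (2 ^ (k + 1) * p) := by ring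
    have e2 : 2 ^ (k + 2) = 2 * 2 ^ (k + 1) := by ring
    have e3 : 2 ^ (k + 1) * (2 * p + 1) = 2 * (2 ^ (k + 1) * p) + 2 ^ (k + 1) := by ring
    have e4 : 2 ^ (k + 1) = 2 * 2 ^ k := by ring
    rw [e1, e2] at hd hd'
    rw [e3] at hwk
    have hk : k + 1 < n + 2 := by
      refine (Nat.pow_lt_pow_iff_right (a := 2) (by norm_num)).1 ?_
      omega
    have hkr : k ∈ Finset.range (n + 1) := Finset.mem_range.2 (by omega)
    have h1 := hN k hkr
    have h2 := heP k hkr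
    have hpP : p = P k := by
      have e5 : 2 ^ (k + 1) * (6 * p + 2) = 6 * (2 ^ (k + 1) * p) + 2 * 2 ^ (k + 1) := by ring
      have e6 : 2 ^ (k + 1) * (6 * P k + 2 + 2 * e k) =
        6 * (2 ^ (k + 1) * P k) + 2 * 2 ^ (k + 1) + 2 * (2 ^ (k + 1) * e k) := by ring
      have h7 : 2 ^ (k + 1) * (6 * P k + 2 + 2 * e k) < 2 ^ (k + 1) * (6 * p + 5) := by
        have : 2 ^ (k + 1) * (6 * p + 5) = 6 * (2 ^ (k + 1) * p) + 5 * 2 ^ (k + 1) := by ring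
        omega
      have h8 : 2 ^ (k + 1) * (6 * p + 1) < 2 ^ (k + 1) * (6 * P k + 2 + 2 * e k) := by
        have : 2 ^ (k + 1) * (6 * p + 1) = 6 * (2 ^ (k + 1) * p) + 2 ^ (k + 1) := by ring
        omega
      have h9 := Nat.lt_of_mul_lt_mul_left h7
      have h10 := Nat.lt_of_mul_lt_mul_left h8
      have := he k hkr
      omega
    subst hpP
    refine ⟨⟨k, (u - (2 * (2 ^ (k + 1) * P k) + 2 ^ (k + 1) * e k)) / 2⟩, ?_, ?_⟩
    · simp only [Finset.mem_sigma, hkr, true_and, Finset.mem_range]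
      omega
    · simp only [Prod.mk.injEq]
      omega

open Classical in
-- With u = v the even member is twice an odd number, so the condition is u + 2⌊u/4⌋ + 1 = 2^(n+1).
-- Writing u = 4q + r with r = 1 or 3 gives 6q + r + 1 = 2^(n+1), whose residue mod 6 fixes `r` and
-- then `q`.
theorem card_oddPairs_diag_left (n : ℕ) :
    ((oddPairs (n + 2)).filter fun p => p.1 = p.2 ∧
      IsDyadicPair p.1 (2 ^ (n + 2) - (p.1 + p.2))).card = 1 := by
  have h4 : 2 ^ (n + 2) = 2 * 2 ^ (n + 1) := by ring
  have h2 : 2 ^ (n + 1) % 2 = 0 := by rw [pow_succ]; omega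
  have hm := two_pow_succ_mod_six n
  have key : ∀ u, u % 2 = 1 → u + u < 2 ^ (n + 2) →
      (IsDyadicPair u (2 ^ (n + 2) - (u + u)) ↔ u + 2 * (u / 4) + 1 = 2 ^ (n + 1)) := by
    intro u hu hlt
    obtain ⟨p, hp⟩ : ∃ p, 2 ^ (n + 1) = u + 2 * p + 1 := ⟨(2 ^ (n + 1) - u - 1) / 2, by omega⟩
    rw [show 2 ^ (n + 2) - (u + u) = 2 ^ (0 + 1) * (2 * p + 1) by omega, isDyadicPair_odd_iff hu]
    norm_num
    omega
  rw [Finset.card_eq_one]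
  obtain ⟨u₀, h₀, h₁, h₂⟩ : ∃ u₀, u₀ % 2 = 1 ∧ u₀ + 2 * (u₀ / 4) + 1 = 2 ^ (n + 1) ∧
      ∀ u, u % 2 = 1 → u + 2 * (u / 4) + 1 = 2 ^ (n + 1) → u = u₀ := by
    rcases hm with hm | hm
    · exact ⟨4 * (2 ^ (n + 1) / 6) + 1, by omega, by omega, fun u => by omega⟩
    · exact ⟨4 * (2 ^ (n + 1) / 6) + 3, by omega, by omega, fun u => by omega⟩
  refine ⟨(u₀, u₀), ?_⟩
  ext ⟨u, v⟩
  simp only [Finset.mem_filter, mem_oddPairs, Finset.mem_singleton, Prod.mk.injEq]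
  constructor
  · rintro ⟨⟨hu, -, hlt⟩, rfl, hd⟩
    have := h₂ u hu ((key u hu hlt).1 hd)
    exact ⟨this, this⟩
  · rintro ⟨h, h'⟩
    rw [h, h']
    have hlt : u₀ + u₀ < 2 ^ (n + 2) := by omega
    exact ⟨⟨h₀, h₀, hlt⟩, rfl, (key u₀ h₀ hlt).2 h₁⟩

open Classical in
/-- The pairs in `nonDyadicPairs n` both of whose entries are odd. -/
noncomputable def oddNonDyadicPairs (n : ℕ) : Finset (ℕ × ℕ) :=
  (oddPairs n).filter fun p => ¬ (p.1 = p.2 ∨ IsDyadicPair p.1 (2 ^ n - (p.1 + p.2)) ∨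
    IsDyadicPair p.2 (2 ^ n - (p.1 + p.2)))

open Classical in
-- Inclusion-exclusion over the three ways to be dyadic; on the diagonal the last two coincide.
theorem card_oddNonDyadicPairs (n : ℕ) :
    (oddNonDyadicPairs (n + 2)).card + 2 * (n + 1) * 2 ^ n = 2 * 4 ^ n := by
  have h0 := card_oddPairs (n + 1)
  have hA := card_oddPairs_left n
  have hB := card_oddPairs_right n
  have hD := card_oddPairs_diag n
  have hAB := card_oddPairs_left_right n
  have hDA := card_oddPairs_diag_left n
  have hs := Finset.card_filter_add_card_filter_not (s := oddPairs (n + 2))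
    (fun p => p.1 = p.2 ∨ IsDyadicPair p.1 (2 ^ (n + 2) - (p.1 + p.2)) ∨
      IsDyadicPair p.2 (2 ^ (n + 2) - (p.1 + p.2)))
  have hDAB : ((oddPairs (n + 2)).filter fun p => p.1 = p.2 ∧
      (IsDyadicPair p.1 (2 ^ (n + 2) - (p.1 + p.2)) ∨
      IsDyadicPair p.2 (2 ^ (n + 2) - (p.1 + p.2)))).card = 1 := by
    rw [← hDA]
    congr 1
    refine Finset.filter_congr fun p _ => and_congr_right fun h => ?_
    rw [h, or_self]
  have u1 := Finset.card_union_add_card_inter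
    ((oddPairs (n + 2)).filter fun p => IsDyadicPair p.1 (2 ^ (n + 2) - (p.1 + p.2)))
    ((oddPairs (n + 2)).filter fun p => IsDyadicPair p.2 (2 ^ (n + 2) - (p.1 + p.2)))
  have u2 := Finset.card_union_add_card_inter
    ((oddPairs (n + 2)).filter fun p => p.1 = p.2)
    ((oddPairs (n + 2)).filter fun p => IsDyadicPair p.1 (2 ^ (n + 2) - (p.1 + p.2)) ∨
      IsDyadicPair p.2 (2 ^ (n + 2) - (p.1 + p.2)))
  rw [← Finset.filter_or, ← Finset.filter_and] at u1 u2
  rw [hA, hB, hAB] at u1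
  rw [hD, hDAB] at u2
  have hM : (oddNonDyadicPairs (n + 2)).card = ((oddPairs (n + 2)).filter fun p =>
    ¬ (p.1 = p.2 ∨ IsDyadicPair p.1 (2 ^ (n + 2) - (p.1 + p.2)) ∨
      IsDyadicPair p.2 (2 ^ (n + 2) - (p.1 + p.2)))).card := rfl
  rw [← hM] at hs
  have h2 : 2 ^ (n + 1) = 2 * 2 ^ n := by ring
  have h3 : 2 ^ (n + 1) * (2 ^ (n + 1) - 1) + 2 * 2 ^ n = 4 * (2 ^ n * 2 ^ n) := by
    obtain ⟨d, hd⟩ : ∃ d, 2 * 2 ^ n = d + 1 := ⟨2 * 2 ^ n - 1, by have := Nat.two_pow_pos n; omega⟩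
    rw [h2, hd, Nat.add_sub_cancel]
    have : 4 * (2 ^ n * 2 ^ n) = (2 * 2 ^ n) * (2 * 2 ^ n) := by ring
    rw [this, hd]; ring
  have h4 : 4 ^ n = 2 ^ n * 2 ^ n := by rw [← mul_pow]; norm_num
  have h5 : 2 * (n + 1) * 2 ^ n = (n + 1) * 2 ^ n + (n + 1) * 2 ^ n := by ring
  have h6 := Nat.two_pow_pos n
  rw [show n + 1 + 1 = n + 2 from rfl] at h0
  omega

open Classical in
theorem mem_oddNonDyadicPairs {n u v : ℕ} : (u, v) ∈ oddNonDyadicPairs n ↔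
    u % 2 = 1 ∧ v % 2 = 1 ∧ (u, v) ∈ nonDyadicPairs n := by
  rw [oddNonDyadicPairs, Finset.mem_filter, mem_oddPairs, mem_nonDyadicPairs]
  constructor
  · rintro ⟨⟨hu, hv, h⟩, hn⟩
    rw [isDyadicPair_odd_odd hu hv]
    push Not at hn
    exact ⟨hu, hv, by omega, by omega, h, hn⟩
  · rintro ⟨hu, hv, h1, h2, h, hn⟩
    rw [isDyadicPair_odd_odd hu hv] at hn
    exact ⟨⟨hu, hv, h⟩, by tauto⟩

/-! ### Recursion for the non-dyadic pairs -/

theorem nonDyadicPairs_swap_right {n u v : ℕ} (h : (u, v) ∈ nonDyadicPairs n) :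
    (u, 2 ^ n - (u + v)) ∈ nonDyadicPairs n := by
  rw [mem_nonDyadicPairs] at h ⊢
  rw [show 2 ^ n - (u + (2 ^ n - (u + v))) = v by omega, isDyadicPair_comm (u := 2 ^ n - (u + v))]
  exact ⟨by omega, by omega, by omega, by tauto⟩

theorem nonDyadicPairs_swap {n u v : ℕ} (h : (u, v) ∈ nonDyadicPairs n) :
    (v, u) ∈ nonDyadicPairs n := by
  rw [mem_nonDyadicPairs] at h ⊢
  rw [isDyadicPair_comm (u := v), add_comm v u]
  exact ⟨by omega, by omega, by omega, by tauto⟩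

theorem two_mul_mem_nonDyadicPairs {n u v : ℕ} :
    (2 * u, 2 * v) ∈ nonDyadicPairs (n + 1) ↔ (u, v) ∈ nonDyadicPairs n := by
  rw [mem_nonDyadicPairs, mem_nonDyadicPairs,
    show 2 ^ (n + 1) - (2 * u + 2 * v) = 2 * (2 ^ n - (u + v)) by rw [pow_succ]; omega,
    isDyadicPair_two_mul, isDyadicPair_two_mul, isDyadicPair_two_mul, pow_succ]
  constructor <;> rintro ⟨h1, h2, h3, h4⟩ <;> exact ⟨by omega, by omega, by omega, h4⟩

/-- The three members have an even sum, so all are even or exactly two are odd. Permuting the triple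
moves the even member to the implicit third place. -/
theorem nonDyadicPairs_succ (n : ℕ) : nonDyadicPairs (n + 1) =
    ((nonDyadicPairs n).image fun p => (2 * p.1, 2 * p.2)) ∪
    (oddNonDyadicPairs (n + 1) ∪
    (((oddNonDyadicPairs (n + 1)).image fun p => (p.1, 2 ^ (n + 1) - (p.1 + p.2))) ∪
    ((oddNonDyadicPairs (n + 1)).image fun p => (2 ^ (n + 1) - (p.1 + p.2), p.1)))) := by
  have hp : 2 ^ (n + 1) = 2 * 2 ^ n := by ring
  ext ⟨u, v⟩
  simp only [Finset.mem_union, Finset.mem_image, Prod.exists, Prod.mk.injEq]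
  constructor
  · intro h
    have h0 := mem_nonDyadicPairs.1 h
    rcases Nat.mod_two_eq_zero_or_one u with hu | hu <;>
      rcases Nat.mod_two_eq_zero_or_one v with hv | hv
    · left
      refine ⟨u / 2, v / 2, ?_, by omega, by omega⟩
      rw [← two_mul_mem_nonDyadicPairs]
      rwa [show 2 * (u / 2) = u by omega, show 2 * (v / 2) = v by omega]
    · right; right; right
      exact ⟨v, 2 ^ (n + 1) - (v + u), mem_oddNonDyadicPairs.2 ⟨hv, by omega,
        nonDyadicPairs_swap_right (nonDyadicPairs_swap h)⟩, by omega, rfl⟩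
    · right; right; left
      exact ⟨u, 2 ^ (n + 1) - (u + v), mem_oddNonDyadicPairs.2 ⟨hu, by omega,
        nonDyadicPairs_swap_right h⟩, rfl, by omega⟩
    · right; left
      exact mem_oddNonDyadicPairs.2 ⟨hu, hv, h⟩
  · rintro (⟨a, b, h, rfl, rfl⟩ | h | ⟨a, b, h, rfl, rfl⟩ | ⟨a, b, h, rfl, rfl⟩)
    · exact two_mul_mem_nonDyadicPairs.2 h
    · exact (mem_oddNonDyadicPairs.1 h).2.2
    · exact nonDyadicPairs_swap_right (mem_oddNonDyadicPairs.1 h).2.2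
    · exact nonDyadicPairs_swap (nonDyadicPairs_swap_right (mem_oddNonDyadicPairs.1 h).2.2)

theorem card_nonDyadicPairs_succ (n : ℕ) : (nonDyadicPairs (n + 1)).card =
    (nonDyadicPairs n).card + 3 * (oddNonDyadicPairs (n + 1)).card := by
  have hp : 2 ^ (n + 1) = 2 * 2 ^ n := by ring
  have hodd : ∀ {a b : ℕ}, (a, b) ∈ oddNonDyadicPairs (n + 1) →
      a % 2 = 1 ∧ b % 2 = 1 ∧ a + b < 2 ^ (n + 1) := fun h =>
    have h1 := mem_oddNonDyadicPairs.1 h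
    ⟨h1.1, h1.2.1, (mem_nonDyadicPairs.1 h1.2.2).2.2.1⟩
  rw [nonDyadicPairs_succ, Finset.card_union_of_disjoint, Finset.card_union_of_disjoint,
    Finset.card_union_of_disjoint, Finset.card_image_of_injective, Finset.card_image_of_injOn,
    Finset.card_image_of_injOn]
  · ring
  · rintro ⟨a, b⟩ h ⟨a', b'⟩ h' he
    have := hodd h
    have := hodd h'
    simp only [Prod.mk.injEq] at he ⊢; omega
  · rintro ⟨a, b⟩ h ⟨a', b'⟩ h' he
    have := hodd h
    have := hodd h'
    simp only [Prod.mk.injEq] at he ⊢; omega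
  · rintro ⟨a, b⟩ ⟨a', b'⟩ he
    simp only [Prod.mk.injEq] at he ⊢; omega
  all_goals
    rw [Finset.disjoint_left]
    rintro ⟨u, v⟩ h h'
    simp only [Finset.mem_union, Finset.mem_image, Prod.exists, Prod.mk.injEq] at h h'
  · obtain ⟨a, b, h, rfl, rfl⟩ := h
    obtain ⟨a', b', h', h1, h2⟩ := h'
    have := hodd h
    have := hodd h'
    omega
  · have := hodd h
    rcases h' with ⟨a', b', h', h1, h2⟩ | ⟨a', b', h', h1, h2⟩ <;> have := hodd h' <;> omega
  · obtain ⟨a, b, h, rfl, rfl⟩ := h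
    rcases h' with h' | ⟨a', b', h', h1, h2⟩ | ⟨a', b', h', h1, h2⟩ <;> have := hodd h' <;> omega

theorem card_nonDyadicPairs_add_two (n : ℕ) :
    (nonDyadicPairs (n + 2)).card + 6 * (n + 1) * 2 ^ n = (nonDyadicPairs (n + 1)).card + 6 * 4 ^ n
    := by
  have h1 := card_nonDyadicPairs_succ (n + 1)
  have h2 := card_oddNonDyadicPairs n
  rw [show n + 1 + 1 = n + 2 from rfl] at h1
  have h3 : 6 * (n + 1) * 2 ^ n = 3 * (2 * (n + 1) * 2 ^ n) := by ring
  omega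

theorem card_nonDyadicPairs_le_one {n : ℕ} (hn : n ≤ 1) : (nonDyadicPairs n).card = 0 := by
  rw [Finset.card_eq_zero, Finset.eq_empty_iff_forall_notMem]
  rintro ⟨u, v⟩ h
  have h1 := mem_nonDyadicPairs.1 h
  have h2 : 2 ^ n ≤ 2 ^ 1 := Nat.pow_le_pow_right (by norm_num) hn
  omega

/-! ### Initial values and assembly -/

/-- No non-dyadic triple exists below level 4, so nothing has yet fed the recursion U_{n+1} = 3 U_n
+ W_n. -/
theorem card_uncolorablePairs_four : (uncolorablePairs 4).card = 0 := by
  have w0 := card_nonDyadicPairs_le_one (n := 0) (by norm_num)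
  have w1 := card_nonDyadicPairs_le_one (n := 1) le_rfl
  have w2 : (nonDyadicPairs 2).card + 6 = (nonDyadicPairs 1).card + 6 :=
    card_nonDyadicPairs_add_two 0
  have w3 : (nonDyadicPairs 3).card + 24 = (nonDyadicPairs 2).card + 24 :=
    card_nonDyadicPairs_add_two 1
  have t0 : (uncolorablePairs 0).card = 0 := by rw [uncolorablePairs_zero, Finset.card_empty]
  have t1 : (uncolorablePairs 1).card = (uncolorablePairs 0).card +
      (nonDyadicPairs 0).card + 2 * (uncolorablePairs 0).card := by
    rw [← unfitCount_eq_add]; exact card_uncolorablePairs_succ 0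
  have t2 : (uncolorablePairs 2).card = (uncolorablePairs 1).card +
      (nonDyadicPairs 1).card + 2 * (uncolorablePairs 1).card := by
    rw [← unfitCount_eq_add]; exact card_uncolorablePairs_succ 1
  have t3 : (uncolorablePairs 3).card = (uncolorablePairs 2).card +
      (nonDyadicPairs 2).card + 2 * (uncolorablePairs 2).card := by
    rw [← unfitCount_eq_add]; exact card_uncolorablePairs_succ 2
  have t4 : (uncolorablePairs 4).card = (uncolorablePairs 3).card +
      (nonDyadicPairs 3).card + 2 * (uncolorablePairs 3).card := by
    rw [← unfitCount_eq_add]; exact card_uncolorablePairs_succ 3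
  omega

theorem sum_unfitCount (m : ℕ) : ∑ j ∈ Finset.Icc 4 (m + 3), 2 ^ (m + 3 - j) * unfitCount j =
    (uncolorablePairs (m + 4)).card := by
  induction m with
  | zero => simp [card_uncolorablePairs_four]
  | succ m ih =>
    rw [card_uncolorablePairs_succ, ← ih, show m + 1 + 3 = (m + 3) + 1 by ring,
      Finset.sum_Icc_succ_top (by omega), Finset.mul_sum]
    rw [add_comm]
    congr 1
    · simp
    · refine Finset.sum_congr rfl fun j hj => ?_
      rw [Finset.mem_Icc] at hj
      rw [show m + 3 + 1 - j = (m + 3 - j) + 1 by omega, pow_succ]; ring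

theorem mainTheorem4 :
    unfitCount 4 = 24 ∧
      ∀ n : ℕ, 5 ≤ n →
        (unfitCount n : ℤ) =
          2 * (unfitCount (n - 1) : ℤ)
            + ∑ j ∈ Finset.Icc 4 (n - 2), 2 ^ (n - 2 - j) * (unfitCount j : ℤ)
            + 6 * (4 ^ (n - 2) - ((n : ℤ) - 1) * 2 ^ (n - 2)) := by
  constructor
  · have w1 := card_nonDyadicPairs_le_one (n := 1) le_rfl
    have w2 : (nonDyadicPairs 2).card + 6 = (nonDyadicPairs 1).card + 6 :=
      card_nonDyadicPairs_add_two 0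
    have w3 : (nonDyadicPairs 3).card + 24 = (nonDyadicPairs 2).card + 24 :=
      card_nonDyadicPairs_add_two 1
    have w4 : (nonDyadicPairs 4).card + 72 = (nonDyadicPairs 3).card + 96 :=
      card_nonDyadicPairs_add_two 2
    rw [unfitCount_eq_add, card_uncolorablePairs_four]
    omega
  · intro n hn
    obtain ⟨m, rfl⟩ := Nat.exists_eq_add_of_le' hn
    have hs : ∑ j ∈ Finset.Icc 4 (m + 3), (2 : ℤ) ^ (m + 3 - j) * (unfitCount j : ℤ) =
        (uncolorablePairs (m + 4)).card := by
      rw [← sum_unfitCount]; push_cast; rfl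
    have hw := congrArg (Nat.cast (R := ℤ)) (card_nonDyadicPairs_add_two (m + 3))
    have ht := congrArg (Nat.cast (R := ℤ)) (card_uncolorablePairs_succ (m + 4))
    have h5 := congrArg (Nat.cast (R := ℤ)) (unfitCount_eq_add (m + 5))
    have h4 := congrArg (Nat.cast (R := ℤ)) (unfitCount_eq_add (m + 4))
    rw [show m + 5 - 2 = m + 3 by omega, show m + 5 - 1 = m + 4 by omega, hs]
    push_cast at hw ht h5 h4 ⊢
    rw [show m + 4 + 1 = m + 5 from rfl] at ht
    rw [show m + 3 + 2 = m + 5 from rfl, show m + 3 + 1 = m + 4 from rfl] at hw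
    -- Here t_{m+5} = (t_{m+4} + 2 U_{m+4}) + W_{m+5}. The step for W and W_{m+4} = t_{m+4} -
    -- U_{m+4} leave 2 t_{m+4} + U_{m+4} plus the explicit term.
    linear_combination hw + ht + h5 - h4
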